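/- Setting. Let $s\ge 2$ and $c\ge 0$. An almost $s$-Kähler structure of rank 2 on a smooth manifold $X$ of dimension $2(s+1)+c$ consists of a Riemannian metric $g$ and smooth two-forms $\omega_{jk}$, $0\le j,k\le s$, such that * around each point there are coordinates $x_i, y_i^j, z_a$ ($i=1,2$; $1\le j\le s$; $1\le a\le c$) with $\omega_{0j}=\sum_{i=1}^2 dx_i\wedge dy_i^j$ for $j=1,\dots,s$; * for each $p\in X$ there is an adapted coframe at $p$, that is, an orthonormal basis of $T_p^*X$ made of covectors $v_{ij}$ ($i=1,2$, $0\le j\le s$) and $u_1,\dots,u_c$ with $\omega_{jk}=\sum_{i=1}^2 v_{ij}\wedge v_{ik}$ at $p$ for all $j,k$. On $\bigwedge^*T_p^*X$, with the inner product induced by $g$, let $L_{jk}\phi=\omega_{jk}\wedge\phi$ and let $\Lambda_{jk}$ be the adjoint of $L_{jk}$. Let $\mathit{Lef}^s_p\subset \mathrm{End}_{\mathbb R}(\bigwedge^*T_p^*X)$ be the real Lie algebra generated by all $L_{jk},\Lambda_{jk}$ with $j\ne k$; these are the fibres of $\mathit{Lef}^s$. In an adapted coframe at $p$ let $E_{ij}\phi=v_{ij}\wedge\phi$,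 let $I_{ij}$ be the contraction with the tangent vector dual to $v_{ij}$, and put $L_{j\bar k}=\sum_{i=1}^2E_{ij}I_{ik}$ and $L_{\bar j\bar k}=\sum_{i=1}^2 I_{ij}I_{ik}$. Define $$e_i=L_{i,\overline{i-1}}\ (1\le i\le s),\qquad e_{s+1}=L_{\overline{s-1}\,\overline{s}},\qquad f_i=e_i^*,\qquad h_i=[e_i,f_i].$$ Elements $e_i,f_i$ $(1\le i\le s+1)$ of a real Lie algebra $\mathfrak g$, with $h_i=[e_i,f_i]$, are called Serre generators of type $D_{s+1}$ if the $e_i,f_i$ generate $\mathfrak g$, the $h_i$ are linearly independent, and, with $A=(a_{ij})$ the Cartan matrix of type $D_{s+1}$ (nodes $1,\dots,s-1$ form a chain, and the node $s-1$ is also joined to the nodes $s$ and $s+1$): $[h_i,h_j]=0$, $[h_i,e_j]=a_{ij}e_j$ and $[h_i,f_j]=-a_{ij}f_j$ for all $i,j$; and $[e_i,f_j]=0$, $(\mathrm{ad}\,e_i)^{1-a_{ij}}e_j=0$ and $(\mathrm{ad}\,f_i)^{1-a_{ij}}f_j=0$ for $i\ne j$. Theorem. For each $s\ge2$ there are Serre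 generators $E_i,F_i$ ($1\le i\le s+1$) of type $D_{s+1}$ of $\mathfrak{so}(s+1,s+1,\mathbb R)$, which depend only on $s$, such that for every $c\ge0$ and every smooth manifold $X$ of dimension $2(s+1)+c$ with an almost $s$-Kähler structure of rank 2: 1. The operators $e_i$ do not depend on the choice of the adapted coframes, and $e_i,f_i,h_i$ are smooth sections of the bundle $\mathrm{End}_{\mathbb R}(\bigwedge^*T^*X)$. 2. For every $p\in X$ the $e_i,f_i$ lie in $\mathit{Lef}^s_p$ and, with $h_i=[e_i,f_i]$, are Serre generators of type $D_{s+1}$ of $\mathit{Lef}^s_p$. 3. $\mathit{Lef}^s$ is canonically a trivial smooth bundle of Lie algebras with fibre $\mathfrak{so}(s+1,s+1,\mathbb R)$: there is exactly one family of Lie algebra isomorphisms $\Phi_p:\mathfrak{so}(s+1,s+1,\mathbb R)\to\mathit{Lef}^s_p$, $p\in X$, with $\Phi_p(E_i)=e_i$ and $\Phi_p(F_i)=f_i$ at $p$ for all $i$ and $p$, and it is a smooth trivialization: for each open $U\subset X$ and each map $\xi:U\to\mathfrak{so}(s+1,s+1,\mathbb R)$, the section $p\mapsto\Phi_p(\xi(p))$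 of $\mathrm{End}_{\mathbb R}(\bigwedge^*T^*X)$ over $U$ is smooth if and only if $\xi$ is smooth. -/

import Mathlib

open scoped Manifold ContDiff

universe u

attribute [local instance 100] LieRing.ofAssociativeRing

noncomputable section

/-! ### Multilinear algebra: the inner product and adjoints on an exterior algebra -/

namespace ExtMetric

open Module LinearMap

variable {W : Type*} [AddCommGroup W] [Module ℝ W]

/-- The projection of the exterior algebra onto its part of degree `k`. -/
def degreeProj (W : Type*) [AddCommGroup W] [Module ℝ W] (k : ℕ) :
    ExteriorAlgebra ℝ W →ₗ[ℝ] ⋀[ℝ]^k W :=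
  DirectSum.component ℝ ℕ (fun k : ℕ => ⋀[ℝ]^k W) k ∘ₗ
    (DirectSum.decomposeLinearEquiv (fun k : ℕ => ⋀[ℝ]^k W)).toLinearMap

/-- The bilinear form which `γ` induces on the part of degree `k`:
`⟨v₁ ∧ … ∧ vₖ, w₁ ∧ … ∧ wₖ⟩ = det (γ vᵢ wⱼ)`. -/
def degreeForm (γ : LinearMap.BilinForm ℝ W) (k : ℕ) : ⋀[ℝ]^k W →ₗ[ℝ] ⋀[ℝ]^k W →ₗ[ℝ] ℝ :=
  exteriorPower.pairingDual ℝ W k ∘ₗ exteriorPower.map k γ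

/-- The bilinear form on the whole exterior algebra which is `degreeForm γ k` in degree `k` and for
which different degrees are orthogonal. -/
def form (γ : LinearMap.BilinForm ℝ W) : LinearMap.BilinForm ℝ (ExteriorAlgebra ℝ W) :=
  DirectSum.toModule ℝ ℕ (Dual ℝ (ExteriorAlgebra ℝ W))
      (fun k => (degreeProj W k).dualMap ∘ₗ degreeForm γ k) ∘ₗ
    (DirectSum.decomposeLinearEquiv (fun k : ℕ => ⋀[ℝ]^k W)).toLinearMap

lemma degreeProj_coe_same {k : ℕ} (x : ⋀[ℝ]^k W) :
    degreeProj W k (x : ExteriorAlgebra ℝ W) = x := by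
  simp only [degreeProj, coe_comp, LinearEquiv.coe_coe, Function.comp_apply,
    DirectSum.decomposeLinearEquiv_apply, DirectSum.decompose_coe]
  exact DirectSum.component.lof_self ℝ (ι := ℕ) (M := fun k : ℕ => ⋀[ℝ]^k W) k x

lemma degreeProj_coe_ne {k l : ℕ} (h : k ≠ l) (x : ⋀[ℝ]^k W) :
    degreeProj W l (x : ExteriorAlgebra ℝ W) = 0 := by
  simp only [degreeProj, coe_comp, LinearEquiv.coe_coe, Function.comp_apply,
    DirectSum.decomposeLinearEquiv_apply, DirectSum.decompose_coe]
  exact (DirectSum.component.of ℝ (ι := ℕ) (M := fun k : ℕ => ⋀[ℝ]^k W) l k x).trans (dif_neg h)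

lemma form_coe (γ : LinearMap.BilinForm ℝ W) {k : ℕ} (x : ⋀[ℝ]^k W) (ψ : ExteriorAlgebra ℝ W) :
    form γ (x : ExteriorAlgebra ℝ W) ψ = degreeForm γ k x (degreeProj W k ψ) := by
  simp only [form, coe_comp, LinearEquiv.coe_coe, Function.comp_apply,
    DirectSum.decomposeLinearEquiv_apply, DirectSum.decompose_coe]
  rw [← DirectSum.lof_eq_of ℝ, DirectSum.toModule_lof]
  rfl

/-- On decomposable elements of the same degree the form is the Gram determinant. -/
lemma form_ιMulti (γ : LinearMap.BilinForm ℝ W) {k : ℕ} (v w : Fin k → W) :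
    form γ (ExteriorAlgebra.ιMulti ℝ k v) (ExteriorAlgebra.ιMulti ℝ k w) =
      Matrix.det (.of fun i j => γ (v i) (w j)) := by
  rw [← exteriorPower.ιMulti_apply_coe, ← exteriorPower.ιMulti_apply_coe, form_coe,
    degreeProj_coe_same, degreeForm, coe_comp, Function.comp_apply, exteriorPower.map_apply_ιMulti,
    exteriorPower.pairingDual_ιMulti_ιMulti, ← Matrix.det_transpose]
  rfl

/-- Decomposable elements of different degrees are orthogonal. -/
lemma form_ιMulti_ne (γ : LinearMap.BilinForm ℝ W) {k l : ℕ} (h : k ≠ l) (v : Fin k → W) (w : Fin l → W) :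
    form γ (ExteriorAlgebra.ιMulti ℝ k v) (ExteriorAlgebra.ιMulti ℝ l w) = 0 := by
  rw [← exteriorPower.ιMulti_apply_coe, ← exteriorPower.ιMulti_apply_coe, form_coe,
    degreeProj_coe_ne h.symm, map_zero]

instance [FiniteDimensional ℝ W] : FiniteDimensional ℝ (ExteriorAlgebra ℝ W) :=
  Module.Finite.of_basis (Module.finBasis ℝ W).ExteriorAlgebra

lemma form_nondegenerate [FiniteDimensional ℝ W] {γ : LinearMap.BilinForm ℝ W} (hγ : γ.Nondegenerate) :
    (form γ).Nondegenerate := by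
  classical
  let b := Module.finBasis ℝ W
  let d := γ.dualBasis hγ b
  have hd : ∀ i, γ (d i) = b.coord i := fun i => b.ext fun j => by
    rw [LinearMap.BilinForm.apply_dualBasis_left, Basis.coord_apply, Basis.repr_self,
      Finsupp.single_apply]
  have key : ∀ S T, form γ (d.ExteriorAlgebra S) (b.ExteriorAlgebra T) = if S = T then 1 else 0 := by
    intro S₀ T₀
    obtain ⟨k, S, rfl⟩ : ∃ k, ∃ S : Set.powersetCard (Fin (finrank ℝ W)) k, S.val = S₀ :=
      ⟨_, Set.powersetCard.ofCard rfl, rfl⟩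
    obtain ⟨l, T, rfl⟩ : ∃ k, ∃ S : Set.powersetCard (Fin (finrank ℝ W)) k, S.val = T₀ :=
      ⟨_, Set.powersetCard.ofCard rfl, rfl⟩
    rw [ExteriorAlgebra.basis_eq_coe_basis, ExteriorAlgebra.basis_eq_coe_basis, form_coe]
    by_cases hkl : k = l
    · subst hkl
      rw [degreeProj_coe_same, degreeForm, coe_comp, Function.comp_apply,
        exteriorPower.basis_apply, exteriorPower.basis_apply,
        exteriorPower.map_apply_ιMulti_family]
      have : ⇑γ ∘ ⇑d = b.coord := funext hd
      rw [this]
      change exteriorPower.ιMultiDual ℝ k b S _ = _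
      by_cases h : S = T
      · subst h
        simp [exteriorPower.ιMultiDual_apply_diag]
      · rw [exteriorPower.ιMultiDual_apply_nondiag _ _ _ _ _ h,
          if_neg (fun h' => h (Subtype.ext h'))]
    · rw [degreeProj_coe_ne (Ne.symm hkl), map_zero, if_neg]
      intro h
      exact hkl (by rw [← Set.powersetCard.card_eq S, h, Set.powersetCard.card_eq T])
  constructor
  · intro x hx
    apply d.ExteriorAlgebra.ext_elem
    intro T
    have h := hx (b.ExteriorAlgebra T)
    rw [← d.ExteriorAlgebra.sum_repr x] at h
    simp only [map_sum, map_smul, LinearMap.sum_apply, LinearMap.smul_apply, key] at h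
    simpa using h
  · intro x hx
    apply b.ExteriorAlgebra.ext_elem
    intro T
    have h := hx (d.ExteriorAlgebra T)
    rw [← b.ExteriorAlgebra.sum_repr x] at h
    simp only [map_sum, map_smul, key] at h
    simpa using h

/-- The adjoint of an endomorphism of the exterior algebra, with respect to the form which the
nondegenerate form `γ` induces. -/
def adjoint [FiniteDimensional ℝ W] (γ : LinearMap.BilinForm ℝ W) (hγ : γ.Nondegenerate)
    (A : Module.End ℝ (ExteriorAlgebra ℝ W)) : Module.End ℝ (ExteriorAlgebra ℝ W) :=
  (form γ).leftAdjointOfNondegenerate (form_nondegenerate hγ) A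

end ExtMetric

/-! ### Serre generators -/

/-- `e i`, `f i` and `h i = ⁅e i, f i⁆` are Serre generators of the Lie algebra `L`, of the type
given by the Cartan matrix `A`: the `e i` and `f i` generate `L`, the `h i` are linearly
independent, and the Serre relations hold. -/
structure IsSerreGenerators {ι L : Type*} [LieRing L] [LieAlgebra ℝ L] (A : Matrix ι ι ℤ)
    (e f : ι → L) : Prop where
  generate : LieSubalgebra.lieSpan ℝ L (Set.range e ∪ Set.range f) = ⊤
  linearIndependent : LinearIndependent ℝ fun i => ⁅e i, f i⁆
  lie_h_h : ∀ i j, ⁅⁅e i, f i⁆, ⁅e j, f j⁆⁆ = 0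
  lie_h_e : ∀ i j, ⁅⁅e i, f i⁆, e j⁆ = A i j • e j
  lie_h_f : ∀ i j, ⁅⁅e i, f i⁆, f j⁆ = -(A i j • f j)
  lie_e_f : ∀ i j, i ≠ j → ⁅e i, f j⁆ = 0
  ad_e : ∀ i j, i ≠ j → (LieAlgebra.ad ℝ L (e i) ^ (1 - A i j).toNat) (e j) = 0
  ad_f : ∀ i j, i ≠ j → (LieAlgebra.ad ℝ L (f i) ^ (1 - A i j).toNat) (f j) = 0

/-! ### Differential forms on a manifold -/

section Manifold

variable {n : ℕ} {X : Type*} [TopologicalSpace X] [ChartedSpace (EuclideanSpace ℝ (Fin n)) X]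

/-- The cotangent space of `X` at `p`. -/
abbrev CotSpace (n : ℕ) {X : Type*} [TopologicalSpace X]
    [ChartedSpace (EuclideanSpace ℝ (Fin n)) X] (p : X) : Type :=
  Module.Dual ℝ (TangentSpace (𝓡 n) p)

/-- The exterior algebra of the cotangent space of `X` at `p`. -/
abbrev Forms (n : ℕ) {X : Type*} [TopologicalSpace X]
    [ChartedSpace (EuclideanSpace ℝ (Fin n)) X] (p : X) : Type :=
  ExteriorAlgebra ℝ (CotSpace n p)

instance (p : X) : FiniteDimensional ℝ (TangentSpace (𝓡 n) p) :=
  inferInstanceAs (FiniteDimensional ℝ (EuclideanSpace ℝ (Fin n)))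

/-- A covector as a form of degree one. -/
abbrev covec {p : X} (v : CotSpace n p) : Forms n p := ExteriorAlgebra.ι ℝ v

/-- The differential at `q` of the `a`-th coordinate function of the chart `χ`. -/
def coordDiff (χ : OpenPartialHomeomorph X (EuclideanSpace ℝ (Fin n))) (a : Fin n) (q : X) :
    CotSpace n q :=
  (mfderiv (𝓡 n) 𝓘(ℝ, ℝ) (fun x => χ x a) q).toLinearMap

variable [IsManifold (𝓡 n) ∞ X]

/-- The expression of a form at `p` in the local trivialization around `x₀` (which is given by the
preferred chart at `x₀`): the pull-back under the map `ℝⁿ → T_p X`. -/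
def formToCoord (x₀ p : X) :
    Forms n p →ₐ[ℝ] ExteriorAlgebra ℝ (Module.Dual ℝ (EuclideanSpace ℝ (Fin n))) :=
  ExteriorAlgebra.map ((trivializationAt (EuclideanSpace ℝ (Fin n))
    (TangentSpace (𝓡 n) : X → Type) x₀).symmL ℝ p).toLinearMap.dualMap

/-- The inverse of `formToCoord x₀ p`, for `p` in the domain of the trivialization around `x₀`: the
pull-back under the map `T_p X → ℝⁿ`. -/
def formOfCoord (x₀ p : X) :
    ExteriorAlgebra ℝ (Module.Dual ℝ (EuclideanSpace ℝ (Fin n))) →ₐ[ℝ] Forms n p :=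
  ExteriorAlgebra.map ((trivializationAt (EuclideanSpace ℝ (Fin n))
    (TangentSpace (𝓡 n) : X → Type) x₀).continuousLinearMapAt ℝ p).toLinearMap.dualMap

/-- The domain of the local trivialization around `x₀`. -/
def trivDomain (n : ℕ) {X : Type*} [TopologicalSpace X]
    [ChartedSpace (EuclideanSpace ℝ (Fin n)) X] [IsManifold (𝓡 n) ∞ X] (x₀ : X) : Set X :=
  (trivializationAt (EuclideanSpace ℝ (Fin n)) (TangentSpace (𝓡 n) : X → Type) x₀).baseSet

/-- A differential form (a section of the exterior algebra of the cotangent bundle) is smooth on `U`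
if its coefficients in the local trivializations are. -/
def SmoothFormOn (α : (p : X) → Forms n p) (U : Set X) : Prop :=
  ∀ (x₀ : X) (l : Module.Dual ℝ (ExteriorAlgebra ℝ (Module.Dual ℝ (EuclideanSpace ℝ (Fin n))))),
    ContMDiffOn (𝓡 n) 𝓘(ℝ, ℝ) ∞ (fun p => l (formToCoord x₀ p (α p))) (U ∩ trivDomain n x₀)

/-- A section of the bundle of endomorphisms of the exterior algebra of the cotangent bundle is
smooth on `U` if its matrix coefficients in the local trivializations are. -/
def SmoothEndOn (A : (p : X) → Module.End ℝ (Forms n p)) (U : Set X) : Prop :=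
  ∀ (x₀ : X) (ξ : ExteriorAlgebra ℝ (Module.Dual ℝ (EuclideanSpace ℝ (Fin n))))
    (l : Module.Dual ℝ (ExteriorAlgebra ℝ (Module.Dual ℝ (EuclideanSpace ℝ (Fin n))))),
    ContMDiffOn (𝓡 n) 𝓘(ℝ, ℝ) ∞ (fun p => l (formToCoord x₀ p (A p (formOfCoord x₀ p ξ))))
      (U ∩ trivDomain n x₀)

/-! ### Riemannian metrics on the cotangent spaces and on forms -/

/-- A smooth Riemannian metric on `X`. -/
abbrev RiemMetric (n : ℕ) (X : Type*) [TopologicalSpace X]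
    [ChartedSpace (EuclideanSpace ℝ (Fin n)) X] [IsManifold (𝓡 n) ∞ X] :=
  Bundle.ContMDiffRiemannianMetric (𝓡 n) ∞ (EuclideanSpace ℝ (Fin n))
    (TangentSpace (𝓡 n) : X → Type)

/-- The inner product on the tangent space at `p`. -/
def tangentForm (g : RiemMetric n X) (p : X) :
    LinearMap.BilinForm ℝ (TangentSpace (𝓡 n) p) :=
  LinearMap.mk₂ ℝ (fun v w => g.inner p v w) (by simp) (by simp) (by simp) (by simp)

lemma tangentForm_nondegenerate (g : RiemMetric n X) (p : X) :
    (tangentForm g p).Nondegenerate := by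
  have key : ∀ v : TangentSpace (𝓡 n) p, tangentForm g p v v = 0 → v = 0 := fun v hv => by
    by_contra h
    exact (g.pos p v h).ne' hv
  exact ⟨fun v hv => key v (hv v), fun v hv => key v (hv v)⟩

/-- The inner product on the cotangent space at `p`: that of the tangent space, transported along
the isomorphism `v ↦ g(v, ·)`. -/
def cotangentForm (g : RiemMetric n X) (p : X) : LinearMap.BilinForm ℝ (CotSpace n p) :=
  LinearMap.BilinForm.congr ((tangentForm g p).toDual (tangentForm_nondegenerate g p))
    (tangentForm g p)

lemma cotangentForm_nondegenerate (g : RiemMetric n X) (p : X) :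
    (cotangentForm g p).Nondegenerate :=
  (tangentForm_nondegenerate g p).congr _

/-- The pointwise adjoint of an operator on forms with respect to a Riemannian metric. -/
def formAdjoint (g : RiemMetric n X) (p : X) (A : Module.End ℝ (Forms n p)) :
    Module.End ℝ (Forms n p) :=
  ExtMetric.adjoint (cotangentForm g p) (cotangentForm_nondegenerate g p) A

/-! ### Almost `s`-Kähler structures -/

/-- A basis of the cotangent space at `p`, made of covectors `v i j = b (inl (i, j))` and
`u a = b (inr a)`, is an adapted coframe for the metric `g` and the two-forms `twoForm j k` if it is
orthonormal and `twoForm j k = ∑ i, v i j ∧ v i k`. -/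
structure IsAdaptedCoframe {s r c : ℕ} (g : RiemMetric n X)
    (twoForm : Fin (s + 1) → Fin (s + 1) → (p : X) → Forms n p) (p : X)
    (b : Module.Basis ((Fin r × Fin (s + 1)) ⊕ Fin c) ℝ (CotSpace n p)) : Prop where
  orthonormal : ∀ a a', cotangentForm g p (b a) (b a') = if a = a' then 1 else 0
  twoForm_eq : ∀ j k, twoForm j k p = ∑ i, covec (b (.inl (i, j))) * covec (b (.inl (i, k)))

/-- An almost `s`-Kähler structure of rank `r` on a smooth manifold `X` of dimension
`n = (s + 1) r + c`. The field `darboux` says that `twoForm 0 1, …, twoForm 0 s` is a polysymplectic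
structure: around each point there is a chart of the smooth structure whose coordinate functions,
labelled by `σ` as `x i` (label `inl (i, 0)`), `y i j` (label `inl (i, j)`, `j ≠ 0`) and `z a`
(label `inr a`), satisfy `twoForm 0 j = ∑ i, d(x i) ∧ d(y i j)` on the domain of the chart. In
particular these forms are closed. -/
structure AlmostSKahler (s r c n : ℕ) (X : Type*) [TopologicalSpace X]
    [ChartedSpace (EuclideanSpace ℝ (Fin n)) X] [IsManifold (𝓡 n) ∞ X] where
  dim_eq : n = (s + 1) * r + c
  metric : RiemMetric n X
  twoForm : Fin (s + 1) → Fin (s + 1) → (p : X) → Forms n p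
  smooth_twoForm : ∀ j k, SmoothFormOn (twoForm j k) Set.univ
  darboux : ∀ p : X, ∃ χ ∈ IsManifold.maximalAtlas (𝓡 n) ∞ X, p ∈ χ.source ∧
    ∃ σ : (Fin r × Fin (s + 1)) ⊕ Fin c ≃ Fin n, ∀ q ∈ χ.source, ∀ j, j ≠ 0 →
      twoForm 0 j q = ∑ i, covec (coordDiff χ (σ (.inl (i, 0))) q) *
        covec (coordDiff χ (σ (.inl (i, j))) q)
  exists_coframe : ∀ p : X,
    ∃ b : Module.Basis ((Fin r × Fin (s + 1)) ⊕ Fin c) ℝ (CotSpace n p),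
      IsAdaptedCoframe metric twoForm p b

/-! ### Operators in a coframe -/

section Coframe

variable {s r c : ℕ} {p : X}

/-- The operators `E i j` (for `α = inl j`), the wedge product with `v i j`, and `I i j` (for
`α = inr j`), the contraction with the tangent vector dual to `v i j` in the coframe `b`. Thus `inl j`
is the index `j` and `inr j` the barred index. -/
def cliffordOp (b : Module.Basis ((Fin r × Fin (s + 1)) ⊕ Fin c) ℝ (CotSpace n p)) (i : Fin r) :
    Fin (s + 1) ⊕ Fin (s + 1) → Module.End ℝ (Forms n p)
  | .inl j => LinearMap.mulLeft ℝ (covec (b (.inl (i, j))))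
  | .inr j => CliffordAlgebra.contractLeft (b.coord (.inl (i, j)))

/-- The operators `L α β` for indices with or without bars: `∑ i, E i j E i k`, `∑ i, E i j I i k`,
`∑ i, I i j E i k`, `∑ i, I i j I i k`. -/
def quadraticOp (b : Module.Basis ((Fin r × Fin (s + 1)) ⊕ Fin c) ℝ (CotSpace n p))
    (α β : Fin (s + 1) ⊕ Fin (s + 1)) : Module.End ℝ (Forms n p) :=
  ∑ i, cliffordOp b i α * cliffordOp b i β

/-- The operators `e₁, …, e_{s+1}`, numbered from `0` to `s`: the one with number `i < s` is `L α β`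
for `α = i + 1` and `β` the barred index `i`, and the one with number `s` is `L α β` for the barred
indices `α = s - 1` and `β = s`. -/
def raisingOp (b : Module.Basis ((Fin r × Fin (s + 1)) ⊕ Fin c) ℝ (CotSpace n p))
    (i : Fin (s + 1)) : Module.End ℝ (Forms n p) :=
  if h : (i : ℕ) < s then quadraticOp b (.inl ⟨i + 1, by omega⟩) (.inr i)
  else quadraticOp b (.inr ⟨s - 1, by omega⟩) (.inr (Fin.last s))

end Coframe

namespace AlmostSKahler

variable {s r c : ℕ} (S : AlmostSKahler s r c n X)

/-- The operator `L j k` on forms at `p`: the wedge product with `twoForm j k`. -/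
def L (j k : Fin (s + 1)) (p : X) : Module.End ℝ (Forms n p) :=
  LinearMap.mulLeft ℝ (S.twoForm j k p)

/-- The operator `Λ j k`, the adjoint of `L j k`. -/
def Λ (j k : Fin (s + 1)) (p : X) : Module.End ℝ (Forms n p) :=
  formAdjoint S.metric p (S.L j k p)

/-- The fibre at `p` of the bundle `Lef^s`: the Lie algebra of operators on forms at `p` which the
`L j k` and `Λ j k` with `j ≠ k` generate. -/
def Lef (p : X) : LieSubalgebra ℝ (Module.End ℝ (Forms n p)) :=
  LieSubalgebra.lieSpan ℝ (Module.End ℝ (Forms n p))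
    {A | ∃ j k, j ≠ k ∧ (A = S.L j k p ∨ A = S.Λ j k p)}

/-- Some adapted coframe at `p`. -/
def coframe (p : X) : Module.Basis ((Fin r × Fin (s + 1)) ⊕ Fin c) ℝ (CotSpace n p) :=
  (S.exists_coframe p).choose

/-- The operators `e₁, …, e_{s+1}` at `p` (numbered from `0` to `s`), computed in some adapted
coframe. -/
def e (i : Fin (s + 1)) (p : X) : Module.End ℝ (Forms n p) :=
  raisingOp (S.coframe p) i

/-- The adjoints `f₁, …, f_{s+1}` of the operators `e₁, …, e_{s+1}`. -/
def f (i : Fin (s + 1)) (p : X) : Module.End ℝ (Forms n p) :=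
  formAdjoint S.metric p (S.e i p)

/-- A family of Lie algebra isomorphisms from `𝔤` to the fibres of `Lef^s` is a trivialization of the
smooth bundle of Lie algebras `Lef^s`: over each open set a section of `Lef^s` is smooth as a
section of the bundle of endomorphisms if and only if the corresponding `𝔤`-valued function is. -/
def IsSmoothTrivialization {𝔤 : Type*} [LieRing 𝔤] [LieAlgebra ℝ 𝔤]
    (Φ : (p : X) → 𝔤 ≃ₗ⁅ℝ⁆ S.Lef p) : Prop :=
  ∀ (U : Set X) (_ : IsOpen U) (ξ : X → 𝔤),
    SmoothEndOn (fun p => (Φ p (ξ p) : Module.End ℝ (Forms n p))) U ↔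
      ∀ l : Module.Dual ℝ 𝔤, ContMDiffOn (𝓡 n) 𝓘(ℝ, ℝ) ∞ (fun p => l (ξ p)) U

end AlmostSKahler

end Manifold

end

/-!
Let `l` be the set of indices `0, …, s`, and let `l ⊕ l` be the set of indices without and with
bars. In an adapted coframe the wedge products and contractions `c i α` (`i = 1, 2`, `α ∈ l ⊕ l`)
satisfy the canonical anticommutation relations, with `α` paired with its opposite `α.swap`
(`isCliffordSystem_cliffordOp`). For any such system the quadratic expressions
`∑ i, c i α * c i β` bracket with the `c i γ` by the defining representation of the Lie algebra of
matrices that are skew for the hyperbolic form on `ℝ^(l ⊕ l)`. So this Lie algebra, Mathlib's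
`typeD l ℝ`, which is isomorphic to `so(s + 1, s + 1)`, acts on forms (`IsCliffordSystem.rep`),
and faithfully so, since a matrix can be read off from its brackets with the `c i γ`.

The operators `L j k`, `Λ j k`, `e i` and `f i` are the images of matrices
`elem α β = e_{αβ} - e_{β'α'}`; for `Λ` and `f` this holds because wedge products and contractions
are adjoint to each other in an orthonormal coframe, which in turn is the expansion of the Gram
determinant along a column (`ExtMetric.form_contractLeft`). As `s ≥ 2`, there is a third index `m`
besides `i` and `i + 1`, and computing with matrices shows, in the numbering from `0`, that
`e i = ⁅L (i + 1) m, Λ i m⁆` for `i < s`, while the last one, `e s`, is some `Λ j k`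
(`AlmostSKahler.exists_formula`). These formulas do not mention the coframe. Hence the `e i` are
independent of it, they lie in `Lef` together with the `f i`, and they are smooth once the `L j k`
and `Λ j k` are.

The matrices that correspond to the `e i` and `f i` are Serre generators
(`SplitOrthogonal.isSerreGenerators`): the `h i` are diagonal, their coordinates being the simple
roots, and the relations `(ad e_i)^(1 - a_ij) e_j = 0` hold in every finite-dimensional Lie
algebra in which the others do, by the representation theory of `sl₂`
(`IsSerreGenerators.of_finiteDimensional`). As they generate, the image of the representation is
exactly `Lef`, which gives the isomorphisms `AlmostSKahler.lefEquiv`, and a homomorphism is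
determined by its values on them, which gives uniqueness.

For smoothness, the adjoint of a wedge product is built from contractions with the metric duals of
coordinate covectors, and these solve a linear system with smooth coefficients
(`SmoothFormOn.formAdjoint_mulLeft`). In a local trivialization the isomorphisms become a smooth
family `T` of injective linear maps, as they take smooth values on generators; if `T ξ` is smooth
then so is `ξ = (Tᵀ T)⁻¹ Tᵀ (T ξ)` (`SmoothVecOn.of_injective`, which also solves the system
above).
-/

noncomputable section

/-! ### Serre generators of an abstract Lie algebra -/

namespace IsSerreGenerators

variable {ι L L' : Type*} [LieRing L] [LieAlgebra ℝ L] [LieRing L'] [LieAlgebra ℝ L']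
  {A : Matrix ι ι ℤ} {e f : ι → L}

/-- In a finite-dimensional Lie algebra the relations `(ad eᵢ) ^ (1 - aᵢⱼ) eⱼ = 0` follow from the
other Serre relations: `fⱼ` is a primitive vector of weight `-aᵢⱼ` for the `sl₂`-triple
`(hᵢ, eᵢ, fᵢ)`, and likewise with the roles of `e` and `f` exchanged. -/
lemma of_finiteDimensional [FiniteDimensional ℝ L] (hdiag : ∀ i, A i i = 2)
    (hoff : ∀ i j, i ≠ j → A i j ≤ 0)
    (generate : LieSubalgebra.lieSpan ℝ L (Set.range e ∪ Set.range f) = ⊤)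
    (linearIndependent : LinearIndependent ℝ fun i => ⁅e i, f i⁆)
    (lie_h_h : ∀ i j, ⁅⁅e i, f i⁆, ⁅e j, f j⁆⁆ = 0)
    (lie_h_e : ∀ i j, ⁅⁅e i, f i⁆, e j⁆ = A i j • e j)
    (lie_h_f : ∀ i j, ⁅⁅e i, f i⁆, f j⁆ = -(A i j • f j))
    (lie_e_f : ∀ i j, i ≠ j → ⁅e i, f j⁆ = 0) :
    IsSerreGenerators A e f := by
  have triple : ∀ i, IsSl2Triple ⁅e i, f i⁆ (e i) (f i) := fun i =>
    { h_ne_zero := linearIndependent.ne_zero i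
      lie_e_f := rfl
      lie_h_e_nsmul := by rw [lie_h_e, hdiag]; norm_cast
      lie_h_f_nsmul := by rw [lie_h_f, hdiag]; norm_cast }
  have cast : ∀ i j, i ≠ j → (-(A i j : ℝ)) = ((-A i j).toNat : ℝ) := fun i j h => by
    have : (((-A i j).toNat : ℤ) : ℝ) = ((-A i j : ℤ) : ℝ) := by
      rw [Int.toNat_of_nonneg (by have := hoff i j h; omega)]
    push_cast at this
    exact this.symm
  have exponent : ∀ i j, i ≠ j → (1 - A i j).toNat = (-A i j).toNat + 1 := fun i j h => by
    have := hoff i j h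
    omega
  refine ⟨generate, linearIndependent, lie_h_h, lie_h_e, lie_h_f, lie_e_f, ?_, ?_⟩
  · intro i j h
    have P : (triple i).symm.HasPrimitiveVectorWith (e j) (-(A i j : ℝ)) :=
      { ne_zero := (triple j).e_ne_zero
        lie_h := by rw [neg_lie, lie_h_e, neg_smul, Int.cast_smul_eq_zsmul]
        lie_e := by rw [← lie_skew, lie_e_f j i h.symm, neg_zero] }
    rw [exponent i j h]
    exact P.pow_toEnd_f_eq_zero_of_eq_nat (cast i j h)
  · intro i j h
    have P : (triple i).HasPrimitiveVectorWith (f j) (-(A i j : ℝ)) :=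
      { ne_zero := (triple j).f_ne_zero
        lie_h := by rw [lie_h_f, neg_smul, Int.cast_smul_eq_zsmul]
        lie_e := lie_e_f i j h }
    rw [exponent i j h]
    exact P.pow_toEnd_f_eq_zero_of_eq_nat (cast i j h)

lemma congr {e' f' : ι → L} (h : IsSerreGenerators A e f) (he : ∀ i, e i = e' i)
    (hf : ∀ i, f i = f' i) : IsSerreGenerators A e' f' := by
  obtain rfl : e = e' := funext he
  obtain rfl : f = f' := funext hf
  exact h

lemma ad_pow_map_apply (φ : L ≃ₗ⁅ℝ⁆ L') (k : ℕ) (x y : L) :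
    (LieAlgebra.ad ℝ L' (φ x) ^ k) (φ y) = φ ((LieAlgebra.ad ℝ L x ^ k) y) := by
  induction k with
  | zero => simp
  | succ k ih =>
    simp only [pow_succ', Module.End.mul_apply, ih, LieAlgebra.ad_apply, LieEquiv.map_lie]

lemma map_equiv (h : IsSerreGenerators A e f) (φ : L ≃ₗ⁅ℝ⁆ L') :
    IsSerreGenerators A (fun i => φ (e i)) (fun i => φ (f i)) where
  generate := by
    have := LieSubalgebra.map_lieSpan (R := ℝ) (f := φ.toLieHom) (s := Set.range e ∪ Set.range f)
    rw [h.generate, Set.image_union, ← Set.range_comp, ← Set.range_comp] at this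
    refine Eq.trans this.symm ?_
    rw [← LieHom.range_eq_map]
    exact φ.toLieHom.range_eq_top.mpr φ.surjective
  linearIndependent := by
    simp only [← LieEquiv.map_lie]
    exact h.linearIndependent.map' φ.toLinearEquiv.toLinearMap φ.toLinearEquiv.ker
  lie_h_h i j := by simp only [← LieEquiv.map_lie, h.lie_h_h, map_zero]
  lie_h_e i j := by simp only [← LieEquiv.map_lie, h.lie_h_e, map_zsmul]
  lie_h_f i j := by simp only [← LieEquiv.map_lie, h.lie_h_f, map_zsmul, map_neg]
  lie_e_f i j hij := by simp only [← LieEquiv.map_lie, h.lie_e_f i j hij, map_zero]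
  ad_e i j hij := by rw [ad_pow_map_apply, h.ad_e i j hij, map_zero]
  ad_f i j hij := by rw [ad_pow_map_apply, h.ad_f i j hij, map_zero]

/-- A homomorphism of Lie algebras is determined by its values on generators. -/
lemma hom_ext (h : IsSerreGenerators A e f) {φ ψ : L →ₗ⁅ℝ⁆ L'} (he : ∀ i, φ (e i) = ψ (e i))
    (hf : ∀ i, φ (f i) = ψ (f i)) : φ = ψ := by
  ext x
  have hx : x ∈ LieSubalgebra.lieSpan ℝ L (Set.range e ∪ Set.range f) := by
    rw [h.generate]; trivial
  induction hx using LieSubalgebra.lieSpan_induction with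
  | mem x hx =>
    rcases hx with ⟨i, rfl⟩ | ⟨i, rfl⟩
    exacts [he i, hf i]
  | zero => simp
  | add x y _ _ hx hy => rw [map_add, map_add, hx, hy]
  | smul a x _ hx => rw [map_smul, map_smul, hx]
  | lie x y _ _ hx hy => rw [LieHom.map_lie, LieHom.map_lie, hx, hy]

end IsSerreGenerators

/-! ### The split orthogonal Lie algebra -/

namespace SplitOrthogonal

open LieAlgebra.Orthogonal Matrix

section General

variable {l : Type*} [Fintype l] [DecidableEq l]

/-- The defining condition of `typeD`: a matrix with rows and columns labelled by `l ⊕ l` is skew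
for the reflection in the antidiagonal, which exchanges and swaps the labels. -/
lemma mem_typeD_iff (A : Matrix (l ⊕ l) (l ⊕ l) ℝ) :
    A ∈ typeD l ℝ ↔ ∀ α β, A α β = -A β.swap α.swap := by
  have hJ : ∀ α β, JD l ℝ α β = if β = α.swap then 1 else 0 := by
    rintro (α | α) (β | β) <;> simp [JD, Matrix.one_apply, eq_comm]
  have hJ' : ∀ α β, JD l ℝ α β = if α = β.swap then 1 else 0 := by
    rintro (α | α) (β | β) <;> simp [JD, Matrix.one_apply]
  rw [typeD, mem_skewAdjointMatricesLieSubalgebra, mem_skewAdjointMatricesSubmodule,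
    Matrix.IsSkewAdjoint, Matrix.IsAdjointPair, ← Matrix.ext_iff]
  have h1 : ∀ α β, (Aᵀ * JD l ℝ) α β = A β.swap α := fun α β => by
    simp [Matrix.mul_apply, hJ', Matrix.transpose_apply]
  have h2 : ∀ α β, (JD l ℝ * -A) α β = -A α.swap β := fun α β => by
    simp [Matrix.mul_apply, hJ]
  simp only [h1, h2]
  constructor
  · intro h α β
    simpa using h β α.swap
  · intro h α β
    simpa using h β.swap α

/-- The elementary elements `e_{αβ} - e_{β'α'}` of the split orthogonal Lie algebra, where `α'` is
the label paired with `α`. -/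
def elem (α β : l ⊕ l) : typeD l ℝ :=
  ⟨single α β 1 - single β.swap α.swap 1, by
    rw [mem_typeD_iff]
    intro γ δ
    have h1 : ∀ a b : l ⊕ l, a = b.swap ↔ a.swap = b := fun a b =>
      ⟨fun h => by rw [h, Sum.swap_swap], fun h => by rw [← h, Sum.swap_swap]⟩
    simp only [Matrix.sub_apply, Matrix.single_apply, Sum.swap_leftInverse.injective.eq_iff, h1,
      neg_sub, and_comm]⟩

lemma coe_elem (α β : l ⊕ l) :
    (elem α β : Matrix (l ⊕ l) (l ⊕ l) ℝ) = single α β 1 - single β.swap α.swap 1 := rfl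

lemma elem_swap (α β : l ⊕ l) : elem β.swap α.swap = -elem α β := by
  ext1
  simp [coe_elem]

lemma elem_self_swap (α : l ⊕ l) : elem α α.swap = 0 := by
  ext1
  simp [coe_elem]

lemma lie_elem (α β γ δ : l ⊕ l) : ⁅elem α β, elem γ δ⁆ =
    (if β = γ then elem α δ else 0) - (if δ = α then elem γ β else 0)
      - (if β = δ.swap then elem α γ.swap else 0) + if γ.swap = α then elem δ.swap β else 0 := by
  have hmul : ∀ a b c d : l ⊕ l, (single a b 1 * single c d 1 : Matrix (l ⊕ l) (l ⊕ l) ℝ) =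
      if b = c then single a d 1 else 0 := fun a b c d => by
    split_ifs with h
    · subst h; simp
    · exact single_mul_single_of_ne _ _ _ _ h _
  have h1 : α.swap = γ ↔ γ.swap = α :=
    ⟨fun h => by rw [← h, Sum.swap_swap], fun h => by rw [← h, Sum.swap_swap]⟩
  have h2 : δ = β.swap ↔ β = δ.swap :=
    ⟨fun h => by rw [h, Sum.swap_swap], fun h => by rw [h, Sum.swap_swap]⟩
  have h3 : γ.swap = β.swap ↔ β = γ := by rw [Sum.swap_leftInverse.injective.eq_iff, eq_comm]
  have h4 : α.swap = δ.swap ↔ δ = α := by rw [Sum.swap_leftInverse.injective.eq_iff, eq_comm]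
  ext1
  rw [LieSubalgebra.coe_bracket, LieRing.of_associative_ring_bracket]
  simp only [coe_elem, sub_mul, mul_sub, hmul, h1, h2, h3, h4]
  split_ifs <;> simp only [AddSubgroupClass.coe_sub, AddMemClass.coe_add, ZeroMemClass.coe_zero,
    coe_elem, Sum.swap_swap] <;> abel

/-- The diagonal element with the entries `a` on the first half of the labels and `-a` on the
second. -/
def diag (a : l → ℝ) : typeD l ℝ :=
  ⟨diagonal (Sum.elim a (-a)), by
    rw [mem_typeD_iff]
    rintro (α | α) (β | β) <;> simp [diagonal_apply, eq_comm]
    all_goals split_ifs with h <;> simp [h]⟩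

lemma lie_diag_diag (a b : l → ℝ) : ⁅diag a, diag b⁆ = 0 := by
  ext1
  rw [LieSubalgebra.coe_bracket, LieRing.of_associative_ring_bracket]
  simp [diag, mul_comm]

lemma lie_diag_elem (a : l → ℝ) (α β : l ⊕ l) :
    ⁅diag a, elem α β⁆ = (Sum.elim a (-a) α - Sum.elim a (-a) β) • elem α β := by
  have hs : ∀ γ : l ⊕ l, Sum.elim a (-a) γ.swap = -Sum.elim a (-a) γ := by
    rintro (γ | γ) <;> simp
  ext1
  rw [LieSubalgebra.coe_bracket, LieRing.of_associative_ring_bracket]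
  change diagonal (Sum.elim a (-a)) * _ - _ * diagonal (Sum.elim a (-a)) = _ • _
  ext γ δ
  simp only [coe_elem, Matrix.sub_apply, diagonal_mul, mul_diagonal, Matrix.smul_apply,
    single_apply, smul_eq_mul]
  split_ifs with h1 h2 h2
  · simp
  · obtain ⟨rfl, rfl⟩ := h1; ring
  · obtain ⟨rfl, rfl⟩ := h2; simp only [hs]; ring
  · ring

lemma diag_injective : Function.Injective (diag (l := l)) := fun a b h => by
  ext j
  simpa [diag] using congr_fun₂ (congr_arg Subtype.val h) (.inl j) (.inl j)

/-- The elementary elements span. By skewness the entries at `(α, β)` and `(β.swap, α.swap)`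
contribute the same, hence the factor `1 / 2`. -/
lemma eq_sum_elem (A : typeD l ℝ) :
    A = (2⁻¹ : ℝ) • ∑ α, ∑ β, (A : Matrix (l ⊕ l) (l ⊕ l) ℝ) α β • elem α β := by
  ext1
  ext γ δ
  have h := (mem_typeD_iff _).1 A.2 γ δ
  have key : ∀ α β : l ⊕ l, (β.swap = γ ∧ α.swap = δ) ↔ (β = γ.swap ∧ α = δ.swap) := fun α β => by
    constructor
    · rintro ⟨rfl, rfl⟩; simp
    · rintro ⟨rfl, rfl⟩; simp
  simp only [SetLike.val_smul, AddSubmonoidClass.coe_finsetSum, Matrix.smul_apply,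
    Matrix.sum_apply, coe_elem, Matrix.sub_apply, single_apply, key, smul_eq_mul, mul_sub,
    Finset.sum_sub_distrib, mul_ite, mul_one, mul_zero, ite_and, Finset.sum_ite_eq',
    Finset.mem_univ, if_true]
  simp
  linarith

end General

/-- `diag` as a linear map. -/
def diagHom {l : Type*} [Fintype l] [DecidableEq l] : (l → ℝ) →ₗ[ℝ] typeD l ℝ where
  toFun := diag
  map_add' a b := by
    ext1
    change diagonal _ = diagonal _ + diagonal _
    rw [diagonal_add]
    congr 1
    ext (i | i) <;> simp [add_comm]
  map_smul' r a := by
    ext1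
    change diagonal _ = r • diagonal _
    rw [← diagonal_smul]
    congr 1
    ext (i | i) <;> simp

section Generation

variable {l : Type*} [Fintype l] [DecidableEq l]

/-- A Lie subalgebra is everything if it contains the `elem (inl j) (inl k)` with `j ≠ k`, that is
the off-diagonal elements of the general linear part, and one pair of opposite elements outside
that part. -/
lemma eq_top_of_elem_mem {K : LieSubalgebra ℝ (typeD l ℝ)}
    (hgl : ∀ j k : l, j ≠ k → elem (.inl j) (.inl k) ∈ K) {a b : l} (hab : a ≠ b)
    (hup : elem (.inr a) (.inl b) ∈ K) (hdown : elem (.inl b) (.inr a) ∈ K) : K = ⊤ := by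
  have anti1 : ∀ j k : l, elem (.inr j) (.inl k) ∈ K → elem (.inr k) (.inl j) ∈ K := fun j k h => by
    have h2 := elem_swap (.inr j : l ⊕ l) (.inl k)
    simp only [Sum.swap_inl, Sum.swap_inr] at h2
    rw [h2]
    exact K.neg_mem h
  have anti2 : ∀ j k : l, elem (.inl j) (.inr k) ∈ K → elem (.inl k) (.inr j) ∈ K := fun j k h => by
    have h2 := elem_swap (.inl j : l ⊕ l) (.inr k)
    simp only [Sum.swap_inl, Sum.swap_inr] at h2
    rw [h2]
    exact K.neg_mem h
  have step1 : ∀ j k m : l, j ≠ k → elem (.inr j) (.inl k) ∈ K → elem (.inr j) (.inl m) ∈ K := by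
    intro j k m hjk h
    by_cases hkm : k = m
    · exact hkm ▸ h
    have := K.lie_mem h (hgl k m hkm)
    rw [lie_elem] at this
    simpa [hjk.symm] using this
  have step2 : ∀ j k m : l, j ≠ k → elem (.inl k) (.inr j) ∈ K → elem (.inl m) (.inr j) ∈ K := by
    intro j k m hjk h
    by_cases hkm : k = m
    · exact hkm ▸ h
    have := K.lie_mem (hgl m k (Ne.symm hkm)) h
    rw [lie_elem] at this
    simpa [hjk, hjk.symm] using this
  have all1 : ∀ j k : l, elem (.inr j) (.inl k) ∈ K := fun j k => by
    by_cases hj : j = a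
    · exact hj ▸ step1 a b k hab hup
    · exact step1 j a k hj (anti1 _ _ (step1 a b j hab hup))
  have all2 : ∀ j k : l, elem (.inl j) (.inr k) ∈ K := fun j k => by
    by_cases hk : k = a
    · exact hk ▸ step2 a b j hab hdown
    · exact step2 k a j hk (anti2 _ _ (step2 a b k hab hdown))
  -- Brackets give the sums and the differences of two diagonal elements, hence these themselves.
  have hsum : ∀ j k : l, j ≠ k → elem (.inl j) (.inl j) + elem (.inl k) (.inl k) ∈ K := by
    intro j k hjk
    have := K.lie_mem (all2 j k) (all1 k j)
    have h2 := elem_swap (.inl k : l ⊕ l) (.inl k)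
    simp only [Sum.swap_inl] at h2
    rw [lie_elem, h2] at this
    simpa [hjk, hjk.symm, h2] using this
  have hdiff : ∀ j k : l, j ≠ k → elem (.inl j) (.inl j) - elem (.inl k) (.inl k) ∈ K := by
    intro j k hjk
    have := K.lie_mem (hgl j k hjk) (hgl k j hjk.symm)
    rw [lie_elem] at this
    simpa [hjk, hjk.symm] using this
  have hdiag : ∀ j : l, elem (.inl j) (.inl j) ∈ K := fun j => by
    obtain ⟨k, hk⟩ : ∃ k, j ≠ k := by
      by_cases hj : j = a
      · exact ⟨b, hj ▸ hab⟩
      · exact ⟨a, hj⟩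
    have h2 : elem (.inl j) (.inl j) = (2⁻¹ : ℝ) • ((elem (.inl j) (.inl j) +
        elem (.inl k) (.inl k)) + (elem (.inl j) (.inl j) - elem (.inl k) (.inl k))) := by
      module
    rw [h2]
    exact K.smul_mem _ (K.add_mem (hsum j k hk) (hdiff j k hk))
  have hgl' : ∀ j k : l, elem (.inl j) (.inl k) ∈ K := fun j k => by
    by_cases h : j = k
    · exact h ▸ hdiag j
    · exact hgl j k h
  have all : ∀ α β : l ⊕ l, elem α β ∈ K := by
    rintro (j | j) (k | k)
    · exact hgl' j k
    · exact all2 j k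
    · exact all1 j k
    · have h2 := elem_swap (.inl k : l ⊕ l) (.inl j)
      simp only [Sum.swap_inl] at h2
      rw [h2]
      exact K.neg_mem (hgl' k j)
  refine eq_top_iff.2 fun A _ => ?_
  rw [eq_sum_elem A]
  exact K.smul_mem _ (sum_mem fun α _ => sum_mem fun β _ => K.smul_mem _ (all α β))

end Generation

section Generators

variable (s : ℕ)

/-- The row and column `(α, β)` of the elementary element that is the `i`-th raising generator, in
the numbering `0, …, s` of the nodes. -/
def node (i : Fin (s + 1)) :
    (Fin (s + 1) ⊕ Fin (s + 1)) × (Fin (s + 1) ⊕ Fin (s + 1)) :=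
  if h : (i : ℕ) < s then (.inl ⟨i + 1, by omega⟩, .inl i)
  else (.inr ⟨s - 1, by omega⟩, .inl (Fin.last s))

/-- The raising generators of the split orthogonal Lie algebra. -/
def raising (i : Fin (s + 1)) : typeD (Fin (s + 1)) ℝ := elem (node s i).1 (node s i).2

/-- The lowering generators of the split orthogonal Lie algebra, the transposes of the raising
ones. -/
def lowering (i : Fin (s + 1)) : typeD (Fin (s + 1)) ℝ := elem (node s i).2 (node s i).1

/-- The simple root of the node `i`, with respect to the standard coordinates of the diagonal
elements: `ε_{i+1} - ε_i` for `i < s`, and `-ε_{s-1} - ε_s` for `i = s`. -/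
def simpleRoot (i k : Fin (s + 1)) : ℤ :=
  if (i : ℕ) < s then (if (k : ℕ) = i + 1 then 1 else if (k : ℕ) = i then -1 else 0)
  else (if (k : ℕ) = s ∨ (k : ℕ) + 1 = s then -1 else 0)

variable {s}

lemma lie_raising_lowering_self (hs : 2 ≤ s) (i : Fin (s + 1)) :
    ⁅raising s i, lowering s i⁆ = diag fun k => (simpleRoot s i k : ℝ) := by
  have hne : (node s i).1 ≠ (node s i).2 := by
    unfold node; split_ifs <;> simp [Fin.ext_iff]
  have hsw : (node s i).1 ≠ (node s i).2.swap := by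
    unfold node; split_ifs <;> simp [Fin.ext_iff]; omega
  have hsw' : (node s i).2 ≠ (node s i).1.swap := fun h => hsw (by rw [h, Sum.swap_swap])
  rw [raising, lowering, lie_elem, if_pos rfl, if_pos rfl, if_neg hsw', if_neg hsw.symm]
  ext1
  ext γ δ
  simp only [diag, diagonal_apply, sub_zero, add_zero, AddSubgroupClass.coe_sub, coe_elem,
    Matrix.sub_apply, single_apply, simpleRoot, node]
  rcases γ with γ | γ <;> rcases δ with δ | δ <;> by_cases h : (i : ℕ) < s <;>
    simp [h, Fin.ext_iff] <;> split_ifs <;> first | omega | norm_num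

/-- The value of the root of the `j`-th generator on the `i`-th diagonal element is the entry of the
Cartan matrix of type `D`. -/
lemma simpleRoot_pairing (hs : 2 ≤ s) (i j : Fin (s + 1)) :
    (Sum.elim (fun k => (simpleRoot s i k : ℝ)) (-fun k => (simpleRoot s i k : ℝ)) (node s j).1 -
      Sum.elim (fun k => (simpleRoot s i k : ℝ)) (-fun k => (simpleRoot s i k : ℝ)) (node s j).2) =
      (CartanMatrix.D (s + 1) i j : ℝ) := by
  have hi := i.2
  have hj := j.2
  unfold node
  split_ifs with h
  · simp only [Sum.elim_inl, ← Int.cast_sub, Int.cast_inj]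
    simp only [simpleRoot, CartanMatrix.D, Matrix.of_apply, Fin.ext_iff]
    split_ifs <;> omega
  · simp only [Sum.elim_inl, Sum.elim_inr, Pi.neg_apply, ← Int.cast_neg, ← Int.cast_sub,
      Int.cast_inj]
    have h1 : ∀ k : Fin (s + 1), (k : ℕ) = s → simpleRoot s i k =
        if (i : ℕ) + 1 = s then 1 else if (i : ℕ) = s then -1 else 0 := fun k hk => by
      simp only [simpleRoot, hk, true_or, if_true]
      split_ifs <;> omega
    have h2 : ∀ k : Fin (s + 1), (k : ℕ) + 1 = s → simpleRoot s i k =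
        if (i : ℕ) + 2 = s then 1 else if (i : ℕ) + 1 = s ∨ (i : ℕ) = s then -1 else 0 :=
      fun k hk => by
        simp only [simpleRoot, hk, or_true, if_true]
        split_ifs <;> omega
    have h3 : CartanMatrix.D (s + 1) i j =
        if (i : ℕ) = s then 2 else if (i : ℕ) + 2 = s then -1 else 0 := by
      have hjs : (j : ℕ) = s := by omega
      have hs' : ¬s + 1 ≤ 2 := by omega
      clear h1 h2
      rw [CartanMatrix.D, Matrix.of_apply, if_neg hs']
      by_cases a1 : (i : ℕ) = s
      · rw [if_pos (Fin.ext (a1.trans hjs.symm)), if_pos a1]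
      rw [if_neg fun h => a1 (by rw [h, hjs]), if_neg a1, if_neg (by omega), if_neg (by omega)]
      by_cases a2 : (i : ℕ) + 2 = s
      · rw [if_pos (by omega), if_pos a2]
      · rw [if_neg (by omega), if_neg (by omega), if_neg a2]
    rw [h1 _ (Fin.val_last s), h2 ⟨s - 1, by omega⟩ (by simp only []; omega), h3]
    clear h1 h2 h3
    split_ifs <;> omega

lemma linearIndependent_simpleRoot (hs : 2 ≤ s) :
    LinearIndependent ℝ fun i k : Fin (s + 1) => (simpleRoot s i k : ℝ) := by
  rw [Fintype.linearIndependent_iff]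
  intro c hc
  -- The coordinates below `s - 1` form a triangular system; the last two coordinates then give two
  -- equations for the last two coefficients.
  have hsum : ∀ k, ∑ i, c i * (simpleRoot s i k : ℝ) = 0 := fun k => by
    simpa using congr_fun hc k
  have hlow : ∀ (m : ℕ) (i : Fin (s + 1)), (i : ℕ) = m → m + 1 < s → c i = 0 := by
    intro m
    induction m using Nat.strong_induction_on with
    | _ m ih =>
      intro i hi hm
      have h := hsum i
      rw [Finset.sum_eq_single i _ (by simp)] at h
      · rw [simpleRoot, if_pos (by omega), if_neg (by omega), if_pos rfl] at h
        push_cast at h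
        linarith
      · intro j _ hj
        rw [Ne, Fin.ext_iff] at hj
        by_cases hji : (j : ℕ) < m
        · rw [ih j hji j rfl (by omega), zero_mul]
        · rw [simpleRoot]
          split_ifs <;> first | omega | simp
  have hz : ∀ i : Fin (s + 1), i ≠ ⟨s - 1, by omega⟩ ∧ i ≠ Fin.last s → c i = 0 := fun i hi => by
    have := i.2
    simp only [Ne, Fin.ext_iff, Fin.val_last] at hi
    exact hlow i i rfl (by omega)
  have hne : (⟨s - 1, by omega⟩ : Fin (s + 1)) ≠ Fin.last s := by
    simp only [Ne, Fin.ext_iff, Fin.val_last]; omega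
  have h1 := hsum ⟨s - 1, by omega⟩
  have h2 := hsum (Fin.last s)
  rw [Finset.sum_eq_add _ _ hne (fun i _ hi => by rw [hz i hi, zero_mul]) (by simp) (by simp)]
    at h1 h2
  rw [simpleRoot, simpleRoot, if_pos (by simp only []; omega), if_neg (by simp), if_pos rfl,
    if_neg (by simp), if_pos (by simp only []; omega)] at h1
  rw [simpleRoot, simpleRoot, if_pos (by simp only []; omega),
    if_pos (by simp only [Fin.val_last]; omega), if_neg (by simp), if_pos (by simp)] at h2
  push_cast at h1 h2
  intro i
  by_cases hi : i = ⟨s - 1, by omega⟩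
  · rw [hi]; linarith
  by_cases hi' : i = Fin.last s
  · rw [hi']; linarith
  exact hz i ⟨hi, hi'⟩

lemma lie_raising_lowering_ne (hs : 2 ≤ s) {i j : Fin (s + 1)} (hij : i ≠ j) :
    ⁅raising s i, lowering s j⁆ = 0 := by
  have hi := i.2
  have hj := j.2
  rw [Ne, Fin.ext_iff] at hij
  rw [raising, lowering, lie_elem]
  unfold node
  by_cases h1 : (i : ℕ) < s <;> by_cases h2 : (j : ℕ) < s
  · simp [h1, h2, Fin.ext_iff, hij, Ne.symm hij]
  · by_cases h3 : (i : ℕ) = s - 1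
    · have h4 : (⟨i + 1, by omega⟩ : Fin (s + 1)) = Fin.last s := by
        rw [Fin.ext_iff, Fin.val_last]; simp only []; omega
      have h5 := elem_self_swap (.inl (Fin.last s) : Fin (s + 1) ⊕ Fin (s + 1))
      simp only [Sum.swap_inl] at h5
      simp [h1, h2, Fin.ext_iff, h1.ne, h4, h5]
    · simp [h1, h2, Fin.ext_iff, h1.ne, h3]
  · by_cases h3 : (j : ℕ) = s - 1
    · have h4 : (⟨j + 1, by omega⟩ : Fin (s + 1)) = Fin.last s := by
        rw [Fin.ext_iff, Fin.val_last]; simp only []; omega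
      have h5 := elem_self_swap (.inr (Fin.last s) : Fin (s + 1) ⊕ Fin (s + 1))
      simp only [Sum.swap_inr] at h5
      simp [h1, h2, Fin.ext_iff, h2.ne', h4, h5]
    · simp [h1, h2, Fin.ext_iff, h2.ne', h3]
  · omega

lemma lieSpan_raising_lowering (hs : 2 ≤ s) :
    LieSubalgebra.lieSpan ℝ (typeD (Fin (s + 1)) ℝ)
      (Set.range (raising s) ∪ Set.range (lowering s)) = ⊤ := by
  set K := LieSubalgebra.lieSpan ℝ (typeD (Fin (s + 1)) ℝ)
      (Set.range (raising s) ∪ Set.range (lowering s)) with hK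
  have hr : ∀ i, raising s i ∈ K := fun i => LieSubalgebra.subset_lieSpan (.inl ⟨i, rfl⟩)
  have hl : ∀ i, lowering s i ∈ K := fun i => LieSubalgebra.subset_lieSpan (.inr ⟨i, rfl⟩)
  -- Brackets of neighbouring elements along the chain of nodes give the general linear part.
  have chain : ∀ (d : ℕ) (j k : Fin (s + 1)), (j : ℕ) = k + d + 1 →
      elem (.inl j) (.inl k) ∈ K ∧ elem (.inl k) (.inl j) ∈ K := by
    intro d
    induction d with
    | zero =>
      intro j k h
      have hj := j.2
      have hk : (k : ℕ) < s := by omega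
      have hjk : j = ⟨k + 1, by omega⟩ := Fin.ext h
      have h1 := hr k
      have h2 := hl k
      rw [raising, node, dif_pos hk] at h1
      rw [lowering, node, dif_pos hk] at h2
      rw [hjk]
      exact ⟨h1, h2⟩
    | succ d ih =>
      intro j k h
      have hj := j.2
      have hm := ih ⟨k + d + 1, by omega⟩ k rfl
      have hn : elem (.inl j) (.inl ⟨k + d + 1, by omega⟩) ∈ K ∧
          elem (.inl ⟨k + d + 1, by omega⟩) (.inl j) ∈ K := by
        have hk : (k : ℕ) + d + 1 < s := by omega
        have hjk : j = ⟨k + d + 1 + 1, by omega⟩ := Fin.ext (by simp only []; omega)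
        have h1 := hr ⟨k + d + 1, by omega⟩
        have h2 := hl ⟨k + d + 1, by omega⟩
        rw [raising, node, dif_pos hk] at h1
        rw [lowering, node, dif_pos hk] at h2
        simp only [hjk]
        exact ⟨h1, h2⟩
      have hjk : j ≠ k := by rw [Ne, Fin.ext_iff]; omega
      have h1 := K.lie_mem hn.1 hm.1
      have h2 := K.lie_mem hm.2 hn.2
      rw [lie_elem] at h1 h2
      exact ⟨by simpa [hjk.symm] using h1, by simpa [hjk] using h2⟩
  have hgl : ∀ j k : Fin (s + 1), j ≠ k → elem (.inl j) (.inl k) ∈ K := fun j k hjk => by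
    rw [Ne, Fin.ext_iff] at hjk
    rcases lt_or_gt_of_ne hjk with h | h
    · exact (chain (k - j - 1) k j (by omega)).2
    · exact (chain (j - k - 1) j k (by omega)).1
  have h1 := hr (Fin.last s)
  have h2 := hl (Fin.last s)
  rw [raising, node, dif_neg (by simp)] at h1
  rw [lowering, node, dif_neg (by simp)] at h2
  exact eq_top_of_elem_mem hgl (fun h => by have := congr_arg Fin.val h; simp at this; omega) h1 h2

/-- The split orthogonal Lie algebra is generated à la Serre by the raising and lowering
generators. -/
theorem isSerreGenerators (hs : 2 ≤ s) :
    IsSerreGenerators (CartanMatrix.D (s + 1)) (raising s) (lowering s) := by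
  refine .of_finiteDimensional (CartanMatrix.D_diag _) (CartanMatrix.D_off_diag_nonpos _)
    (lieSpan_raising_lowering hs) ?_ ?_ ?_ ?_ fun i j => lie_raising_lowering_ne hs
  · simp only [lie_raising_lowering_self hs]
    exact (linearIndependent_simpleRoot hs).map' diagHom (LinearMap.ker_eq_bot.2 diag_injective)
  · intro i j
    rw [lie_raising_lowering_self hs, lie_raising_lowering_self hs, lie_diag_diag]
  · intro i j
    rw [lie_raising_lowering_self hs, raising, lie_diag_elem, simpleRoot_pairing hs,
      Int.cast_smul_eq_zsmul]
  · intro i j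
    rw [lie_raising_lowering_self hs, lowering, lie_diag_elem, ← neg_sub, simpleRoot_pairing hs,
      neg_smul, Int.cast_smul_eq_zsmul]

/-- The isomorphism between the two models of the split orthogonal Lie algebra: matrices which are
skew for the hyperbolic form, and matrices which are skew for the form of signature
`(s + 1, s + 1)`. -/
def soEquiv (s : ℕ) : typeD (Fin (s + 1)) ℝ ≃ₗ⁅ℝ⁆ so' (Fin (s + 1)) (Fin (s + 1)) ℝ :=
  typeDEquivSo' (Fin (s + 1)) ℝ

variable (s) in
/-- The raising generators of `so' (s + 1) (s + 1)`. -/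
def soRaising (i : Fin (s + 1)) : so' (Fin (s + 1)) (Fin (s + 1)) ℝ :=
  soEquiv s (raising s i)

variable (s) in
/-- The lowering generators of `so' (s + 1) (s + 1)`. -/
def soLowering (i : Fin (s + 1)) : so' (Fin (s + 1)) (Fin (s + 1)) ℝ :=
  soEquiv s (lowering s i)

theorem isSerreGenerators_so (hs : 2 ≤ s) :
    IsSerreGenerators (CartanMatrix.D (s + 1)) (soRaising s) (soLowering s) :=
  (isSerreGenerators hs).map_equiv (soEquiv s)

end Generators

end SplitOrthogonal

/-! ### The representation on a Clifford module -/

section CliffordModule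

open LieAlgebra.Orthogonal Matrix

/-- Operators `c i α` which satisfy the canonical anticommutation relations: for each `i` the
operators `c i (inl j)` and `c i (inr j)` are creation and annihilation operators. -/
def IsCliffordSystem {ι l V : Type*} [DecidableEq ι] [DecidableEq l] [AddCommGroup V] [Module ℝ V]
    (c : ι → l ⊕ l → Module.End ℝ V) : Prop :=
  ∀ i j α β, c i α * c j β + c j β * c i α = if i = j ∧ α = β.swap then 1 else 0

namespace IsCliffordSystem

variable {ι l V : Type*} [Fintype ι] [DecidableEq l] [AddCommGroup V]
  [Module ℝ V]

/-- The quadratic expressions in the operators of a Clifford system. -/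
def quad (c : ι → l ⊕ l → Module.End ℝ V) (α β : l ⊕ l) : Module.End ℝ V := ∑ i, c i α * c i β

lemma lie_quad_op [DecidableEq ι] {c : ι → l ⊕ l → Module.End ℝ V} (hc : IsCliffordSystem c)
    (α β γ : l ⊕ l) (i : ι) :
    ⁅quad c α β.swap, c i γ⁆ =
      (if β = γ then c i α else 0) - if α = γ.swap then c i β.swap else 0 := by
  have h : ∀ j, ⁅c j α * c j β.swap, c i γ⁆ =
      if j = i then (if β = γ then c i α else 0) - (if α = γ.swap then c i β.swap else 0)
      else 0 := fun j => by
    have h1 : ⁅c j α * c j β.swap, c i γ⁆ = c j α * (c j β.swap * c i γ + c i γ * c j β.swap) -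
        (c j α * c i γ + c i γ * c j α) * c j β.swap := by
      rw [LieRing.of_associative_ring_bracket]; noncomm_ring
    rw [h1, hc, hc]
    simp only [Sum.swap_leftInverse.injective.eq_iff]
    by_cases hji : j = i
    · subst hji
      simp only [true_and, if_true]
      split_ifs <;> simp
    · simp [hji]
  rw [quad, sum_lie, Finset.sum_congr rfl fun j _ => h j]
  simp

variable [Fintype l]

/-- The action of the split orthogonal Lie algebra through quadratic expressions, as a linear
map. -/
def repLin (c : ι → l ⊕ l → Module.End ℝ V) : typeD l ℝ →ₗ[ℝ] Module.End ℝ V where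
  toFun A := (2⁻¹ : ℝ) • ∑ α, ∑ β, (A : Matrix (l ⊕ l) (l ⊕ l) ℝ) α β • quad c α β.swap
  map_add' A B := by
    simp only [AddMemClass.coe_add, Matrix.add_apply, add_smul, Finset.sum_add_distrib, smul_add]
  map_smul' r A := by
    simp only [SetLike.val_smul, Matrix.smul_apply, smul_assoc, ← Finset.smul_sum,
      RingHom.id_apply]
    rw [smul_comm]

lemma repLin_apply (c : ι → l ⊕ l → Module.End ℝ V) (A : typeD l ℝ) :
    repLin c A = (2⁻¹ : ℝ) • ∑ α, ∑ β, (A : Matrix (l ⊕ l) (l ⊕ l) ℝ) α β • quad c α β.swap := rfl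

variable [DecidableEq ι] {c : ι → l ⊕ l → Module.End ℝ V}

/-- On the span of the operators `c i α`, for fixed `i`, the Lie algebra acts by its defining
representation. -/
lemma lie_repLin_op (hc : IsCliffordSystem c) (A : typeD l ℝ) (i : ι) (γ : l ⊕ l) :
    ⁅repLin c A, c i γ⁆ = ∑ α, (A : Matrix (l ⊕ l) (l ⊕ l) ℝ) α γ • c i α := by
  have hA := (SplitOrthogonal.mem_typeD_iff _).1 A.2
  have h1 : ∑ β, (A : Matrix (l ⊕ l) (l ⊕ l) ℝ) γ.swap β • c i β.swap =
      -∑ α, (A : Matrix (l ⊕ l) (l ⊕ l) ℝ) α γ • c i α := by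
    rw [← Finset.sum_neg_distrib, ← Equiv.sum_comp (Equiv.sumComm l l)]
    refine Finset.sum_congr rfl fun α _ => ?_
    change (A : Matrix (l ⊕ l) (l ⊕ l) ℝ) γ.swap α.swap • c i α.swap.swap = _
    rw [hA γ.swap, Sum.swap_swap, Sum.swap_swap, neg_smul]
  simp only [repLin_apply, smul_lie, sum_lie, hc.lie_quad_op, smul_sub, smul_ite, smul_zero,
    Finset.sum_sub_distrib, Finset.sum_ite_eq', Finset.mem_univ, if_true]
  rw [Finset.sum_comm (f := fun α β => if α = γ.swap then
    (A : Matrix (l ⊕ l) (l ⊕ l) ℝ) α β • c i β.swap else 0)]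
  simp only [Finset.sum_ite_eq', Finset.mem_univ, if_true, h1]
  module

lemma lie_repLin_quad (hc : IsCliffordSystem c) (A : typeD l ℝ) (γ δ : l ⊕ l) :
    ⁅repLin c A, quad c γ δ⁆ = ∑ α, (A : Matrix (l ⊕ l) (l ⊕ l) ℝ) α γ • quad c α δ +
      ∑ α, (A : Matrix (l ⊕ l) (l ⊕ l) ℝ) α δ • quad c γ α := by
  have h : ∀ x y z : Module.End ℝ V, ⁅x, y * z⁆ = ⁅x, y⁆ * z + y * ⁅x, z⁆ := fun x y z => by
    simp only [LieRing.of_associative_ring_bracket]; noncomm_ring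
  simp only [quad, lie_sum, h, hc.lie_repLin_op, Finset.sum_mul, Finset.mul_sum,
    Finset.sum_add_distrib, smul_mul_assoc, mul_smul_comm, Finset.smul_sum]
  congr 1 <;> exact Finset.sum_comm

/-- The representation of the split orthogonal Lie algebra which a Clifford system defines: a matrix
acts by a quadratic expression in the operators of the system. -/
def rep (hc : IsCliffordSystem c) : typeD l ℝ →ₗ⁅ℝ⁆ Module.End ℝ V :=
  { repLin c with
    map_lie' := by
      intro A B
      change repLin c ⁅A, B⁆ = ⁅repLin c A, repLin c B⁆
      have hA := (SplitOrthogonal.mem_typeD_iff _).1 A.2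
      have h1 : ∀ γ δ, ∑ α, (A : Matrix (l ⊕ l) (l ⊕ l) ℝ) α δ.swap • quad c γ α =
          -∑ α, (A : Matrix (l ⊕ l) (l ⊕ l) ℝ) δ α • quad c γ α.swap := fun γ δ => by
        rw [← Finset.sum_neg_distrib, ← Equiv.sum_comp (Equiv.sumComm l l)]
        refine Finset.sum_congr rfl fun α _ => ?_
        change (A : Matrix (l ⊕ l) (l ⊕ l) ℝ) α.swap δ.swap • quad c γ α.swap = _
        rw [hA α.swap, Sum.swap_swap, Sum.swap_swap, neg_smul]
      have h2 : ⁅repLin c A, ∑ γ, ∑ δ, (B : Matrix (l ⊕ l) (l ⊕ l) ℝ) γ δ • quad c γ δ.swap⁆ =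
          ∑ α, ∑ δ, ((A * B - B * A : Matrix (l ⊕ l) (l ⊕ l) ℝ) α δ) • quad c α δ.swap := by
        simp only [lie_sum, lie_smul, hc.lie_repLin_quad, h1, Matrix.sub_apply, Matrix.mul_apply,
          sub_smul, Finset.sum_smul, Finset.sum_sub_distrib, smul_add, smul_neg,
          Finset.sum_add_distrib, Finset.sum_neg_distrib, Finset.smul_sum, smul_smul]
        rw [← sub_eq_add_neg]
        congr 1
        · rw [Finset.sum_comm_cycle]
          refine Finset.sum_congr rfl fun α _ => ?_
          rw [Finset.sum_comm]
          simp only [mul_comm]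
        · exact Finset.sum_congr rfl fun γ _ => Finset.sum_comm
      rw [repLin_apply c B, lie_smul, h2]
      rfl }

lemma rep_apply (hc : IsCliffordSystem c) (A : typeD l ℝ) : hc.rep A = repLin c A := rfl

lemma rep_elem (hc : IsCliffordSystem c) {α β : l ⊕ l} (h : α ≠ β) :
    hc.rep (SplitOrthogonal.elem α β) = quad c α β.swap := by
  have h1 : quad c β.swap α = -quad c α β.swap := by
    rw [eq_neg_iff_add_eq_zero, quad, quad, ← Finset.sum_add_distrib]
    refine Finset.sum_eq_zero fun i _ => ?_
    rw [add_comm, hc, if_neg (by simpa using h)]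
  rw [rep_apply, repLin_apply]
  simp only [SplitOrthogonal.coe_elem, Matrix.sub_apply, single_apply, sub_smul, ite_smul, one_smul,
    zero_smul, Finset.sum_sub_distrib, ite_and, Finset.sum_ite_irrel, Finset.sum_const_zero,
    Finset.sum_ite_eq, Finset.mem_univ, if_true, Sum.swap_swap, h1]
  module

/-- The representation is faithful: the entries of a matrix are the anticommutators of the operators
`c i α` with its brackets with the `c i γ`. -/
lemma rep_injective [Nontrivial V] [Nonempty ι] (hc : IsCliffordSystem c) :
    Function.Injective hc.rep := by
  refine (injective_iff_map_eq_zero _).2 fun A hA => ?_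
  rw [rep_apply] at hA
  obtain ⟨i⟩ := ‹Nonempty ι›
  ext1
  ext α γ
  have h := hc.lie_repLin_op A i γ
  rw [hA, zero_lie] at h
  have h2 : ∑ β, (A : Matrix (l ⊕ l) (l ⊕ l) ℝ) β γ •
      (c i β * c i α.swap + c i α.swap * c i β) = 0 := by
    have h3 : ∀ β, (A : Matrix (l ⊕ l) (l ⊕ l) ℝ) β γ • (c i β * c i α.swap + c i α.swap * c i β) =
        ((A : Matrix (l ⊕ l) (l ⊕ l) ℝ) β γ • c i β) * c i α.swap +
          c i α.swap * ((A : Matrix (l ⊕ l) (l ⊕ l) ℝ) β γ • c i β) := fun β => by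
      rw [smul_add, smul_mul_assoc, mul_smul_comm]
    simp only [h3, Finset.sum_add_distrib, ← Finset.sum_mul, ← Finset.mul_sum, ← h, zero_mul,
      mul_zero, add_zero]
  simp only [hc i i _ _, true_and, Sum.swap_swap, smul_ite, smul_zero, Finset.sum_ite_eq',
    Finset.mem_univ, if_true] at h2
  simpa using h2

end IsCliffordSystem

end CliffordModule

/-! ### Adjoints of wedge products and contractions -/

namespace ExtMetric

open Module CliffordAlgebra

section Contraction

variable {R M N : Type*} [CommRing R] [AddCommGroup M] [Module R M] [AddCommGroup N] [Module R N]

/-- The expansion of a contraction of a decomposable element. -/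
lemma contractLeft_ιMulti (d : Dual R M) {k : ℕ} (w : Fin (k + 1) → M) :
    contractLeft d (ExteriorAlgebra.ιMulti R (k + 1) w) =
      ∑ i : Fin (k + 1),
        ((-1) ^ (i : ℕ) * d (w i)) • ExteriorAlgebra.ιMulti R k (w ∘ i.succAbove) := by
  induction k with
  | zero =>
    rw [ExteriorAlgebra.ιMulti_succ_apply, ExteriorAlgebra.ι, contractLeft_ι_mul]
    simp
  | succ k ih =>
    rw [ExteriorAlgebra.ιMulti_succ_apply, ExteriorAlgebra.ι, contractLeft_ι_mul, ih,
      Fin.sum_univ_succ (n := k + 1), Finset.mul_sum, sub_eq_add_neg, ← Finset.sum_neg_distrib]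
    congr 1
    · simp [Function.comp_def, Matrix.vecTail]
    · refine Finset.sum_congr rfl fun i _ => ?_
      rw [ExteriorAlgebra.ιMulti_succ_apply, mul_smul_comm, ← neg_smul]
      congr 1
      · simp [pow_succ, Matrix.vecTail]
      · have h : Matrix.vecTail (w ∘ i.succ.succAbove) = Matrix.vecTail w ∘ i.succAbove := by
          ext j
          simp [Matrix.vecTail]
        rw [h]
        simp [ExteriorAlgebra.ι]

/-- Contractions are natural with respect to linear maps. -/
lemma map_contractLeft (f : M →ₗ[R] N) (d : Dual R N) (x : ExteriorAlgebra R M) :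
    ExteriorAlgebra.map f (contractLeft (d ∘ₗ f) x) = contractLeft d (ExteriorAlgebra.map f x) := by
  induction x using CliffordAlgebra.left_induction with
  | algebraMap r =>
    rw [contractLeft_algebraMap, AlgHom.commutes, map_zero, contractLeft_algebraMap]
  | add x y hx hy => rw [map_add, map_add, hx, hy, map_add, map_add]
  | ι_mul x m hx =>
    rw [contractLeft_ι_mul, map_sub, map_smul, map_mul, map_mul, hx]
    erw [ExteriorAlgebra.map_apply_ι]
    rw [ExteriorAlgebra.ι, contractLeft_ι_mul]
    rfl

end Contraction

variable {W : Type*} [AddCommGroup W] [Module ℝ W]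

/-- Two bilinear maps on an exterior algebra agree if they do so on decomposable elements. -/
lemma bilin_ext {N : Type*} [AddCommGroup N] [Module ℝ N]
    {B C : ExteriorAlgebra ℝ W →ₗ[ℝ] ExteriorAlgebra ℝ W →ₗ[ℝ] N}
    (h : ∀ (k l : ℕ) (v : Fin k → W) (w : Fin l → W),
      B (ExteriorAlgebra.ιMulti ℝ k v) (ExteriorAlgebra.ιMulti ℝ l w) =
        C (ExteriorAlgebra.ιMulti ℝ k v) (ExteriorAlgebra.ιMulti ℝ l w)) : B = C := by
  refine LinearMap.ext_on_range (ExteriorAlgebra.ιMulti_span ℝ W) fun x => ?_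
  exact LinearMap.ext_on_range (ExteriorAlgebra.ιMulti_span ℝ W) fun y => h _ _ _ _

lemma form_symm {γ : LinearMap.BilinForm ℝ W} (hγ : ∀ v w, γ v w = γ w v)
    (x y : ExteriorAlgebra ℝ W) : form γ x y = form γ y x := by
  have : form γ = (form γ).flip := bilin_ext fun k l v w => by
    change _ = form γ _ _
    by_cases hkl : k = l
    · subst hkl
      rw [form_ιMulti, form_ιMulti, ← Matrix.det_transpose]
      congr 1
      ext i j
      exact hγ _ _
    · rw [form_ιMulti_ne _ hkl, form_ιMulti_ne _ (Ne.symm hkl)]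
  exact congr($this x y)

/-- The contraction with `γ(v, ·)` is adjoint to the wedge product with `v`: on decomposable
elements this is the expansion of the Gram determinant along its first column. -/
lemma form_contractLeft {γ : LinearMap.BilinForm ℝ W} (hγ : ∀ v w, γ v w = γ w v) (v : W)
    (x y : ExteriorAlgebra ℝ W) :
    form γ (contractLeft (γ v) x) y = form γ x (ExteriorAlgebra.ι ℝ v * y) := by
  have : form γ ∘ₗ contractLeft (γ v) =
      (form γ).compl₂ (LinearMap.mulLeft ℝ (ExteriorAlgebra.ι ℝ v)) := bilin_ext fun k l w u => by
    have hcons : ExteriorAlgebra.ι ℝ v * ExteriorAlgebra.ιMulti ℝ l u =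
        ExteriorAlgebra.ιMulti ℝ (l + 1) (Matrix.vecCons v u) := by
      rw [ExteriorAlgebra.ιMulti_succ_apply]; simp
    rw [LinearMap.compl₂_apply, LinearMap.comp_apply, LinearMap.mulLeft_apply, hcons]
    rcases k with _ | k
    · rw [form_ιMulti_ne _ (by omega), ExteriorAlgebra.ιMulti_zero_apply, contractLeft_one,
        map_zero, LinearMap.zero_apply]
    · rw [contractLeft_ιMulti, map_sum, LinearMap.sum_apply]
      simp only [map_smul, LinearMap.smul_apply, smul_eq_mul]
      by_cases hkl : k = l
      · subst hkl
        rw [form_ιMulti, Matrix.det_succ_column_zero]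
        refine Finset.sum_congr rfl fun i _ => ?_
        rw [form_ιMulti, hγ v]
        rfl
      · rw [form_ιMulti_ne _ (by omega)]
        refine Finset.sum_eq_zero fun i _ => ?_
        rw [form_ιMulti_ne _ hkl, mul_zero]
  exact congr($this x y)

section Adjoint

variable [FiniteDimensional ℝ W] {γ : LinearMap.BilinForm ℝ W} (hγ : γ.Nondegenerate)

lemma form_adjoint (A : Module.End ℝ (ExteriorAlgebra ℝ W)) (x y : ExteriorAlgebra ℝ W) :
    form γ (adjoint γ hγ A x) y = form γ x (A y) :=
  LinearMap.BilinForm.isAdjointPairLeftAdjointOfNondegenerate (form γ) (form_nondegenerate hγ) A x y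

lemma adjoint_eq {A B : Module.End ℝ (ExteriorAlgebra ℝ W)}
    (h : ∀ x y, form γ (B x) y = form γ x (A y)) : adjoint γ hγ A = B :=
  (((form γ).isAdjointPair_iff_eq_of_nondegenerate (form_nondegenerate hγ) B A).1 h).symm

lemma adjoint_mul (A B : Module.End ℝ (ExteriorAlgebra ℝ W)) :
    adjoint γ hγ (A * B) = adjoint γ hγ B * adjoint γ hγ A :=
  adjoint_eq hγ fun x y => by
    rw [Module.End.mul_apply, form_adjoint, form_adjoint, Module.End.mul_apply]

/-- The adjoint as a linear map. -/
def adjointHom : Module.End ℝ (ExteriorAlgebra ℝ W) →ₗ[ℝ] Module.End ℝ (ExteriorAlgebra ℝ W) where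
  toFun := adjoint γ hγ
  map_add' A B := adjoint_eq hγ fun x y => by
    simp only [LinearMap.add_apply, map_add, form_adjoint]
  map_smul' r A := adjoint_eq hγ fun x y => by
    simp only [LinearMap.smul_apply, map_smul, form_adjoint, RingHom.id_apply]

lemma adjoint_one : adjoint γ hγ 1 = 1 := adjoint_eq hγ fun _ _ => rfl

lemma adjoint_mulLeft_ι (hs : ∀ v w, γ v w = γ w v) (v : W) :
    adjoint γ hγ (LinearMap.mulLeft ℝ (ExteriorAlgebra.ι ℝ v)) = contractLeft (γ v) :=
  adjoint_eq hγ fun x y => form_contractLeft hs v x y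

lemma adjoint_contractLeft (hs : ∀ v w, γ v w = γ w v) (v : W) :
    adjoint γ hγ (contractLeft (γ v)) = LinearMap.mulLeft ℝ (ExteriorAlgebra.ι ℝ v) :=
  adjoint_eq hγ fun x y => by
    rw [form_symm hs, form_symm hs x, form_contractLeft hs]
    rfl

end Adjoint

end ExtMetric

/-! ### The operators of an adapted coframe -/

section Coframe

open LieAlgebra.Orthogonal SplitOrthogonal IsCliffordSystem

variable {n : ℕ} {X : Type*} [TopologicalSpace X] [ChartedSpace (EuclideanSpace ℝ (Fin n)) X]
  {s r c : ℕ}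

/-- Wedge products with, and contractions against, the covectors of a coframe satisfy the canonical
anticommutation relations. -/
lemma isCliffordSystem_cliffordOp {p : X}
    (b : Module.Basis ((Fin r × Fin (s + 1)) ⊕ Fin c) ℝ (CotSpace n p)) :
    IsCliffordSystem (cliffordOp b) := by
  have hmixed : ∀ (i j : Fin r) (k l : Fin (s + 1)),
      cliffordOp b i (.inl k) * cliffordOp b j (.inr l) +
        cliffordOp b j (.inr l) * cliffordOp b i (.inl k) = if i = j ∧ k = l then 1 else 0 := by
    intro i j k l
    refine LinearMap.ext fun x => ?_
    change covec _ * CliffordAlgebra.contractLeft _ x +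
      CliffordAlgebra.contractLeft _ (covec _ * x) = _
    rw [covec, ExteriorAlgebra.ι, CliffordAlgebra.contractLeft_ι_mul, add_sub_cancel]
    by_cases h : i = j ∧ k = l
    · obtain ⟨rfl, rfl⟩ := h
      simp
    · have h2 : ¬((i, k) = (j, l)) := by simpa using h
      simp [h, h2]
  rintro i j (k | k) (l | l)
  · rw [if_neg (by simp)]
    refine LinearMap.ext fun x => ?_
    change covec _ * (covec _ * x) + covec _ * (covec _ * x) = 0
    rw [← mul_assoc, ← mul_assoc, ← add_mul, ExteriorAlgebra.ι_add_mul_swap, zero_mul]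
  · simpa using hmixed i j k l
  · rw [add_comm, hmixed j i l k]
    simp [eq_comm]
  · rw [if_neg (by simp)]
    refine LinearMap.ext fun x => ?_
    change CliffordAlgebra.contractLeft _ (CliffordAlgebra.contractLeft _ x) +
      CliffordAlgebra.contractLeft _ (CliffordAlgebra.contractLeft _ x) = 0
    rw [CliffordAlgebra.contractLeft_comm, neg_add_cancel]

lemma raisingOp_eq_rep {p : X}
    (b : Module.Basis ((Fin r × Fin (s + 1)) ⊕ Fin c) ℝ (CotSpace n p)) (i : Fin (s + 1)) :
    raisingOp b i = (isCliffordSystem_cliffordOp b).rep (raising s i) := by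
  have hne : (node s i).1 ≠ (node s i).2 := by
    unfold node; split_ifs <;> simp [Fin.ext_iff]
  rw [raising, rep_elem _ hne, raisingOp, node]
  split_ifs <;> rfl

variable [IsManifold (𝓡 n) ∞ X]

lemma cotangentForm_symm (g : RiemMetric n X) (p : X) (v w : CotSpace n p) :
    cotangentForm g p v w = cotangentForm g p w v :=
  g.symm p _ _

section Adapted

variable {g : RiemMetric n X} {η : Fin (s + 1) → Fin (s + 1) → (p : X) → Forms n p} {p : X}
  {b : Module.Basis ((Fin r × Fin (s + 1)) ⊕ Fin c) ℝ (CotSpace n p)}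

namespace IsAdaptedCoframe

lemma cotangentForm_eq_coord (hb : IsAdaptedCoframe g η p b) (a : (Fin r × Fin (s + 1)) ⊕ Fin c) :
    cotangentForm g p (b a) = b.coord a :=
  b.ext fun a' => by
    rw [hb.orthonormal, Module.Basis.coord_apply, Module.Basis.repr_self, Finsupp.single_apply]
    simp only [eq_comm]

/-- In an orthonormal coframe wedge products and contractions are adjoint to each other. -/
lemma formAdjoint_cliffordOp (hb : IsAdaptedCoframe g η p b) (i : Fin r)
    (α : Fin (s + 1) ⊕ Fin (s + 1)) :
    formAdjoint g p (cliffordOp b i α) = cliffordOp b i α.swap := by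
  rcases α with j | j
  · have := ExtMetric.adjoint_mulLeft_ι (cotangentForm_nondegenerate g p) (cotangentForm_symm g p)
      (b (.inl (i, j)))
    rw [hb.cotangentForm_eq_coord] at this
    exact this
  · have := ExtMetric.adjoint_contractLeft (cotangentForm_nondegenerate g p)
      (cotangentForm_symm g p) (b (.inl (i, j)))
    rw [hb.cotangentForm_eq_coord] at this
    exact this

lemma formAdjoint_quad (hb : IsAdaptedCoframe g η p b) (α β : Fin (s + 1) ⊕ Fin (s + 1)) :
    formAdjoint g p (quad (cliffordOp b) α β) = quad (cliffordOp b) β.swap α.swap := by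
  have h : ∀ A, formAdjoint g p A =
      ExtMetric.adjointHom (cotangentForm_nondegenerate g p) A := fun _ => rfl
  rw [quad, h, map_sum]
  refine Finset.sum_congr rfl fun i _ => ?_
  rw [← hb.formAdjoint_cliffordOp, ← hb.formAdjoint_cliffordOp]
  exact ExtMetric.adjoint_mul _ _ _

lemma formAdjoint_raisingOp (hb : IsAdaptedCoframe g η p b) (i : Fin (s + 1)) :
    formAdjoint g p (raisingOp b i) = (isCliffordSystem_cliffordOp b).rep (lowering s i) := by
  have hne : (node s i).1 ≠ (node s i).2 := by
    unfold node; split_ifs <;> simp [Fin.ext_iff]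
  rw [raisingOp_eq_rep, raising, lowering, rep_elem _ hne, rep_elem _ hne.symm,
    hb.formAdjoint_quad, Sum.swap_swap]

end IsAdaptedCoframe

end Adapted

namespace AlmostSKahler

variable (S : AlmostSKahler s r c n X) {p : X}
  {b : Module.Basis ((Fin r × Fin (s + 1)) ⊕ Fin c) ℝ (CotSpace n p)}

lemma L_eq_quad (hb : IsAdaptedCoframe S.metric S.twoForm p b) (j k : Fin (s + 1)) :
    S.L j k p = quad (cliffordOp b) (.inl j) (.inl k) := by
  refine LinearMap.ext fun x => ?_
  rw [L, hb.twoForm_eq, LinearMap.mulLeft_apply, Finset.sum_mul, quad, LinearMap.sum_apply]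
  exact Finset.sum_congr rfl fun i _ => mul_assoc _ _ _

lemma L_eq_rep (hb : IsAdaptedCoframe S.metric S.twoForm p b) (j k : Fin (s + 1)) :
    S.L j k p = (isCliffordSystem_cliffordOp b).rep (elem (.inl j) (.inr k)) := by
  rw [rep_elem _ (by simp), S.L_eq_quad hb]
  rfl

lemma Λ_eq_rep (hb : IsAdaptedCoframe S.metric S.twoForm p b) (j k : Fin (s + 1)) :
    S.Λ j k p = (isCliffordSystem_cliffordOp b).rep (elem (.inr k) (.inl j)) := by
  rw [rep_elem _ (by simp), Λ, S.L_eq_quad hb, hb.formAdjoint_quad]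
  rfl

/-- The generators are brackets of operators `L` and `Λ`, or such operators themselves, by formulas
in which the coframe does not occur. -/
lemma exists_formula (hs : 2 ≤ s) (i : Fin (s + 1)) :
    (∃ j k m, j ≠ m ∧ k ≠ m ∧ ∀ p b, IsAdaptedCoframe (r := r) (c := c) S.metric S.twoForm p b →
      raisingOp b i = ⁅S.L j m p, S.Λ k m p⁆ ∧
        formAdjoint S.metric p (raisingOp b i) = ⁅S.L k m p, S.Λ j m p⁆) ∨
    (∃ j k, j ≠ k ∧ ∀ p b, IsAdaptedCoframe (r := r) (c := c) S.metric S.twoForm p b →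
      raisingOp b i = S.Λ j k p ∧ formAdjoint S.metric p (raisingOp b i) = S.L j k p) := by
  by_cases h : (i : ℕ) < s
  · -- As `s ≥ 2` there is an index besides `i` and `i + 1`.
    obtain ⟨m, hm, hm'⟩ : ∃ m : Fin (s + 1), i ≠ m ∧ (⟨i + 1, by omega⟩ : Fin (s + 1)) ≠ m := by
      by_cases h0 : (i : ℕ) = 0
      · exact ⟨⟨2, by omega⟩, by rw [Ne, Fin.ext_iff]; simp only []; omega,
          by rw [Ne, Fin.ext_iff]; simp only []; omega⟩
      · exact ⟨⟨0, by omega⟩, by rw [Ne, Fin.ext_iff]; simp only []; omega,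
          by rw [Ne, Fin.ext_iff]; simp only []; omega⟩
    have hi : i ≠ ⟨i + 1, by omega⟩ := by rw [Ne, Fin.ext_iff]; simp only []; omega
    refine .inl ⟨⟨i + 1, by omega⟩, i, m, hm', hm, fun p b hb => ?_⟩
    have h1 : raising s i = ⁅elem (.inl ⟨i + 1, by omega⟩) (.inr m), elem (.inr m) (.inl i)⁆ := by
      rw [lie_elem, raising, node, dif_pos h]
      simp [hi, hm.symm, hm'.symm]
    have h2 : lowering s i = ⁅elem (.inl i) (.inr m), elem (.inr m) (.inl ⟨i + 1, by omega⟩)⁆ := by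
      rw [lie_elem, lowering, node, dif_pos h]
      simp [hi.symm, hm.symm, hm'.symm]
    rw [hb.formAdjoint_raisingOp, raisingOp_eq_rep, S.L_eq_rep hb _ m, S.Λ_eq_rep hb i m,
      S.L_eq_rep hb i m, S.Λ_eq_rep hb _ m, h1, h2]
    exact ⟨LieHom.map_lie _ _ _, LieHom.map_lie _ _ _⟩
  · refine .inr ⟨Fin.last s, ⟨s - 1, by omega⟩, ?_, fun p b hb => ?_⟩
    · exact fun h => by have := congr_arg Fin.val h; simp at this; omega
    have h1 : raising s i = elem (.inr ⟨s - 1, by omega⟩) (.inl (Fin.last s)) := by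
      rw [raising, node, dif_neg h]
    have h2 : lowering s i = elem (.inl (Fin.last s)) (.inr ⟨s - 1, by omega⟩) := by
      rw [lowering, node, dif_neg h]
    constructor
    · rw [raisingOp_eq_rep, h1]
      exact (S.Λ_eq_rep hb _ _).symm
    · rw [hb.formAdjoint_raisingOp, h2]
      exact (S.L_eq_rep hb _ _).symm

lemma isAdaptedCoframe_coframe (p : X) : IsAdaptedCoframe S.metric S.twoForm p (S.coframe p) :=
  (S.exists_coframe p).choose_spec

/-- The operators `e i` do not depend on the adapted coframe. -/
lemma e_eq_raisingOp (hs : 2 ≤ s) (hb : IsAdaptedCoframe S.metric S.twoForm p b) (i : Fin (s + 1)) :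
    S.e i p = raisingOp b i := by
  rcases S.exists_formula hs i with ⟨j, k, m, -, -, h⟩ | ⟨j, k, -, h⟩
  all_goals rw [(h p b hb).1, e, (h p _ (S.isAdaptedCoframe_coframe p)).1]

lemma L_mem_Lef {j k : Fin (s + 1)} (h : j ≠ k) (p : X) : S.L j k p ∈ S.Lef p :=
  LieSubalgebra.subset_lieSpan ⟨j, k, h, .inl rfl⟩

lemma Λ_mem_Lef {j k : Fin (s + 1)} (h : j ≠ k) (p : X) : S.Λ j k p ∈ S.Lef p :=
  LieSubalgebra.subset_lieSpan ⟨j, k, h, .inr rfl⟩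

lemma e_mem_Lef (hs : 2 ≤ s) (i : Fin (s + 1)) (p : X) : S.e i p ∈ S.Lef p := by
  rcases S.exists_formula hs i with ⟨j, k, m, hj, hk, h⟩ | ⟨j, k, hj, h⟩
  all_goals rw [e, (h p _ (S.isAdaptedCoframe_coframe p)).1]
  · exact LieSubalgebra.lie_mem _ (S.L_mem_Lef hj p) (S.Λ_mem_Lef hk p)
  · exact S.Λ_mem_Lef hj p

lemma f_mem_Lef (hs : 2 ≤ s) (i : Fin (s + 1)) (p : X) : S.f i p ∈ S.Lef p := by
  rcases S.exists_formula hs i with ⟨j, k, m, hj, hk, h⟩ | ⟨j, k, hj, h⟩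
  all_goals rw [f, e, (h p _ (S.isAdaptedCoframe_coframe p)).2]
  · exact LieSubalgebra.lie_mem _ (S.L_mem_Lef hk p) (S.Λ_mem_Lef hj p)
  · exact S.L_mem_Lef hj p

/-- The representation of the split orthogonal Lie algebra on the forms at a point, through an
adapted coframe. -/
def lefRep (p : X) : typeD (Fin (s + 1)) ℝ →ₗ⁅ℝ⁆ Module.End ℝ (Forms n p) :=
  (isCliffordSystem_cliffordOp (S.coframe p)).rep

lemma lefRep_raising (i : Fin (s + 1)) (p : X) : S.lefRep p (raising s i) = S.e i p :=
  (raisingOp_eq_rep _ _).symm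

lemma lefRep_lowering (i : Fin (s + 1)) (p : X) : S.lefRep p (lowering s i) = S.f i p :=
  ((S.isAdaptedCoframe_coframe p).formAdjoint_raisingOp i).symm

lemma range_lefRep (hs : 2 ≤ s) (p : X) : (S.lefRep p).range = S.Lef p := by
  apply le_antisymm
  · rw [LieHom.range_eq_map, ← lieSpan_raising_lowering hs, LieSubalgebra.map_lieSpan,
      LieSubalgebra.lieSpan_le, Set.image_union]
    rintro _ (⟨_, ⟨i, rfl⟩, rfl⟩ | ⟨_, ⟨i, rfl⟩, rfl⟩)
    · change S.lefRep p _ ∈ S.Lef p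
      rw [lefRep_raising]
      exact S.e_mem_Lef hs i p
    · change S.lefRep p _ ∈ S.Lef p
      rw [lefRep_lowering]
      exact S.f_mem_Lef hs i p
  · rw [Lef, LieSubalgebra.lieSpan_le]
    rintro _ ⟨j, k, -, rfl | rfl⟩
    · exact ⟨_, (S.L_eq_rep (S.isAdaptedCoframe_coframe p) j k).symm⟩
    · exact ⟨_, (S.Λ_eq_rep (S.isAdaptedCoframe_coframe p) j k).symm⟩

lemma lefRep_injective [NeZero r] (p : X) : Function.Injective (S.lefRep p) :=
  IsCliffordSystem.rep_injective _

/-- The isomorphism of the split orthogonal Lie algebra, as `typeD`, with the fibre of `Lef` at a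
point. -/
def lefEquivTypeD [NeZero r] (hs : 2 ≤ s) (p : X) : typeD (Fin (s + 1)) ℝ ≃ₗ⁅ℝ⁆ S.Lef p :=
  (LieEquiv.ofInjective (S.lefRep p) (S.lefRep_injective p)).trans
    (LieEquiv.ofEq _ _ (by rw [S.range_lefRep hs p]))

/-- The isomorphism of the split orthogonal Lie algebra with the fibre of `Lef` at a point. -/
def lefEquiv [NeZero r] (hs : 2 ≤ s) (p : X) :
    so' (Fin (s + 1)) (Fin (s + 1)) ℝ ≃ₗ⁅ℝ⁆ S.Lef p :=
  (soEquiv s).symm.trans (S.lefEquivTypeD hs p)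

lemma coe_lefEquiv [NeZero r] (hs : 2 ≤ s) (p : X) (A : typeD (Fin (s + 1)) ℝ) :
    (S.lefEquiv hs p (soEquiv s A) : Module.End ℝ (Forms n p)) =
      S.lefRep p A :=
  congrArg (fun B => (S.lefEquivTypeD hs p B : Module.End ℝ (Forms n p)))
    ((soEquiv s).symm_apply_apply A)

lemma coe_lefEquiv_soRaising [NeZero r] (hs : 2 ≤ s) (i : Fin (s + 1)) (p : X) :
    (S.lefEquiv hs p (soRaising s i) : Module.End ℝ (Forms n p)) = S.e i p := by
  rw [soRaising, ← S.lefRep_raising]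
  exact S.coe_lefEquiv hs p (raising s i)

lemma coe_lefEquiv_soLowering [NeZero r] (hs : 2 ≤ s) (i : Fin (s + 1)) (p : X) :
    (S.lefEquiv hs p (soLowering s i) : Module.End ℝ (Forms n p)) = S.f i p := by
  rw [soLowering, ← S.lefRep_lowering]
  exact S.coe_lefEquiv hs p (lowering s i)

lemma isSerreGenerators_Lef [NeZero r] (hs : 2 ≤ s) (p : X) :
    IsSerreGenerators (L := S.Lef p) (CartanMatrix.D (s + 1))
      (fun i => ⟨S.e i p, S.e_mem_Lef hs i p⟩) (fun i => ⟨S.f i p, S.f_mem_Lef hs i p⟩) :=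
  ((isSerreGenerators_so hs).map_equiv (S.lefEquiv hs p)).congr
    (fun i => Subtype.ext (S.coe_lefEquiv_soRaising hs i p))
    (fun i => Subtype.ext (S.coe_lefEquiv_soLowering hs i p))

end AlmostSKahler

end Coframe

/-! ### Smooth functions with values in a finite-dimensional vector space -/

section SmoothFunctions

open Matrix

variable {n : ℕ} {X : Type*} [TopologicalSpace X] [ChartedSpace (EuclideanSpace ℝ (Fin n)) X]

variable (n) in
/-- A function on a manifold with values in a real vector space is smooth on `U` if its composition
with each linear functional is. For finite-dimensional spaces, which need not come with a topology
here, this is smoothness of the coordinates in a basis. -/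
def SmoothVecOn {W : Type*} [AddCommGroup W] [Module ℝ W] (F : X → W) (U : Set X) : Prop :=
  ∀ l : Module.Dual ℝ W, ContMDiffOn (𝓡 n) 𝓘(ℝ, ℝ) ∞ (fun p => l (F p)) U

namespace SmoothVecOn

variable {V W W' : Type*} [AddCommGroup V] [Module ℝ V] [AddCommGroup W] [Module ℝ W]
  [AddCommGroup W'] [Module ℝ W'] {U U' : Set X}

lemma mono {F : X → W} (hF : SmoothVecOn n F U) (h : U' ⊆ U) : SmoothVecOn n F U' :=
  fun l => (hF l).mono h

lemma congr {F G : X → W} (hF : SmoothVecOn n F U) (h : ∀ p ∈ U, G p = F p) : SmoothVecOn n G U :=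
  fun l => (hF l).congr fun p hp => by rw [h p hp]

lemma const (w : W) : SmoothVecOn n (fun _ : X => w) U := fun _ => contMDiffOn_const

lemma of_real {a : X → ℝ} (ha : ContMDiffOn (𝓡 n) 𝓘(ℝ, ℝ) ∞ a U) : SmoothVecOn n a U := fun l => by
  refine (ha.mul (contMDiffOn_const (c := l 1))).congr fun p _ => ?_
  rw [Pi.mul_apply, ← smul_eq_mul, ← map_smul, smul_eq_mul, mul_one]

lemma map {F : X → W} (hF : SmoothVecOn n F U) (T : W →ₗ[ℝ] W') :
    SmoothVecOn n (fun p => T (F p)) U :=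
  fun l => hF (l ∘ₗ T)

lemma add {F G : X → W} (hF : SmoothVecOn n F U) (hG : SmoothVecOn n G U) :
    SmoothVecOn n (fun p => F p + G p) U := fun l => by
  simp only [map_add]
  exact (hF l).add (hG l)

lemma sum {ι : Type*} (s : Finset ι) {F : ι → X → W} (hF : ∀ i ∈ s, SmoothVecOn n (F i) U) :
    SmoothVecOn n (fun p => ∑ i ∈ s, F i p) U := by
  classical
  induction s using Finset.induction_on with
  | empty => simpa using const 0
  | insert i s hi ih =>
    simp only [Finset.sum_insert hi]
    exact (hF i (by simp)).add (ih fun j hj => hF j (by simp [hj]))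

lemma smul {a : X → ℝ} {F : X → W} (ha : ContMDiffOn (𝓡 n) 𝓘(ℝ, ℝ) ∞ a U)
    (hF : SmoothVecOn n F U) : SmoothVecOn n (fun p => a p • F p) U := fun l => by
  simp only [map_smul, smul_eq_mul]
  exact ha.mul (hF l)

lemma of_basis {κ : Type*} [Fintype κ] (b : Module.Basis κ ℝ W) {F : X → W}
    (hF : ∀ k, ContMDiffOn (𝓡 n) 𝓘(ℝ, ℝ) ∞ (fun p => b.repr (F p) k) U) : SmoothVecOn n F U :=
  (sum Finset.univ fun k _ => smul (hF k) (const (b k))).congr fun p _ => (b.sum_repr (F p)).symm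

lemma bilin [FiniteDimensional ℝ V] {F : X → V} {G : X → W} (hF : SmoothVecOn n F U)
    (hG : SmoothVecOn n G U) (B : V →ₗ[ℝ] W →ₗ[ℝ] W') :
    SmoothVecOn n (fun p => B (F p) (G p)) U := by
  let b := Module.finBasis ℝ V
  refine (sum Finset.univ fun k _ => smul (hF (b.coord k)) (hG.map (B (b k)))).congr fun p _ => ?_
  have h := congrArg (fun v => B v (G p)) (b.sum_repr (F p))
  simp only [map_sum, map_smul, LinearMap.sum_apply, LinearMap.smul_apply] at h
  exact h.symm

/-- A family of linear maps is smooth if its values at fixed vectors are. -/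
lemma of_apply [FiniteDimensional ℝ V] {F : X → V →ₗ[ℝ] W}
    (hF : ∀ v, SmoothVecOn n (fun p => F p v) U) : SmoothVecOn n F U := by
  let b := Module.finBasis ℝ V
  refine (sum Finset.univ fun k _ => (hF (b k)).map (LinearMap.smulRightₗ (b.coord k))).congr
    fun p _ => b.ext fun j => ?_
  simp [Finsupp.single_apply, LinearMap.smulRightₗ_apply]

lemma apply [FiniteDimensional ℝ V] [FiniteDimensional ℝ W] {F : X → V →ₗ[ℝ] W} {G : X → V}
    (hF : SmoothVecOn n F U) (hG : SmoothVecOn n G U) : SmoothVecOn n (fun p => F p (G p)) U :=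
  hF.bilin hG LinearMap.id

lemma det {κ : Type*} [Fintype κ] [DecidableEq κ] {M : X → Matrix κ κ ℝ}
    (hM : ∀ i j, ContMDiffOn (𝓡 n) 𝓘(ℝ, ℝ) ∞ (fun p => M p i j) U) :
    ContMDiffOn (𝓡 n) 𝓘(ℝ, ℝ) ∞ (fun p => (M p).det) U := by
  simp only [Matrix.det_apply']
  refine contMDiffOn_finsetSum fun σ _ => contMDiffOn_const.mul ?_
  exact contMDiffOn_finsetProd fun i _ => hM _ _

/-- A function `ξ` is smooth if its image under a smooth family `T` of injective linear maps is: in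
matrix form, `ξ = (Tᵀ T)⁻¹ Tᵀ (T ξ)`. -/
lemma of_injective [FiniteDimensional ℝ V] [FiniteDimensional ℝ W] {T : X → V →ₗ[ℝ] W} {ξ : X → V}
    (hT : SmoothVecOn n T U) (hinj : ∀ p ∈ U, Function.Injective (T p))
    (hξ : SmoothVecOn n (fun p => T p (ξ p)) U) : SmoothVecOn n ξ U := by
  classical
  let bV := Module.finBasis ℝ V
  let bW := Module.finBasis ℝ W
  let M : X → Matrix _ _ ℝ := fun p => LinearMap.toMatrix bV bW (T p)
  let N : X → Matrix _ _ ℝ := fun p => (M p).transpose * M p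
  have hM : ∀ i j, ContMDiffOn (𝓡 n) 𝓘(ℝ, ℝ) ∞ (fun p => M p i j) U := fun i j => by
    simp only [M, LinearMap.toMatrix_apply]
    exact hT (bW.coord i ∘ₗ LinearMap.applyₗ (bV j))
  have hN : ∀ i j, ContMDiffOn (𝓡 n) 𝓘(ℝ, ℝ) ∞ (fun p => N p i j) U := fun i j => by
    simp only [N, Matrix.mul_apply, Matrix.transpose_apply]
    exact contMDiffOn_finsetSum fun k _ => (hM k i).mul (hM k j)
  -- `Tᵀ T` has the same kernel as `T`.
  have hdet : ∀ p ∈ U, (N p).det ≠ 0 := fun p hp => by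
    rw [← isUnit_iff_ne_zero, ← Matrix.isUnit_iff_isUnit_det, ← Matrix.mulVec_injective_iff_isUnit,
      ← Matrix.coe_mulVecLin, ← LinearMap.ker_eq_bot]
    rw [Matrix.ker_mulVecLin_transpose_mul_self, LinearMap.ker_eq_bot]
    intro x y hxy
    have hrepr : ∀ z, M p *ᵥ z = bW.repr (T p (bV.equivFun.symm z)) := fun z => by
      rw [← LinearMap.toMatrix_mulVec_repr bV bW (T p) (bV.equivFun.symm z)]
      congr 1
      exact (bV.equivFun.apply_symm_apply z).symm
    rw [Matrix.mulVecLin_apply, Matrix.mulVecLin_apply, hrepr, hrepr] at hxy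
    exact bV.equivFun.symm.injective (hinj p hp (bW.repr.injective (DFunLike.coe_injective hxy)))
  -- The inverse is the adjugate, which is polynomial in the entries, over the determinant.
  have hadj : ∀ i j, ContMDiffOn (𝓡 n) 𝓘(ℝ, ℝ) ∞ (fun p => (N p).adjugate i j) U := fun i j => by
    simp only [Matrix.adjugate_apply]
    refine det fun k m => ?_
    simp only [Matrix.updateRow_apply]
    split_ifs
    · exact contMDiffOn_const
    · exact hN _ _
  refine of_basis bV fun k => ?_
  have key : ∀ p ∈ U, bV.repr (ξ p) k = (N p).det⁻¹ *
      ∑ i, (N p).adjugate k i * ∑ j, M p j i * bW.repr (T p (ξ p)) j := fun p hp => by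
    have h1 : M p *ᵥ bV.repr (ξ p) = bW.repr (T p (ξ p)) := LinearMap.toMatrix_mulVec_repr _ _ _ _
    have h2 : (N p).adjugate *ᵥ ((M p).transpose *ᵥ bW.repr (T p (ξ p))) =
        (N p).det • ⇑(bV.repr (ξ p)) := by
      rw [← h1, Matrix.mulVec_mulVec, Matrix.mulVec_mulVec, Matrix.mul_assoc,
        Matrix.adjugate_mul, Matrix.smul_mulVec,
        Matrix.one_mulVec]
    have h3 := congr_fun h2 k
    simp only [Matrix.mulVec, dotProduct, Matrix.transpose_apply, Pi.smul_apply, smul_eq_mul] at h3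
    rw [h3, inv_mul_cancel_left₀ (hdet p hp)]
  refine ContMDiffOn.congr ?_ key
  refine ((det hN).inv₀ hdet).mul (contMDiffOn_finsetSum fun i _ => (hadj k i).mul
    (contMDiffOn_finsetSum fun j _ => (hM j i).mul (hξ (bW.coord j))))

end SmoothVecOn

end SmoothFunctions

/-! ### Smooth sections of the endomorphism bundle -/

section SmoothEnd

variable {n : ℕ} {X : Type*} [TopologicalSpace X] [ChartedSpace (EuclideanSpace ℝ (Fin n)) X]
  [IsManifold (𝓡 n) ∞ X]

lemma isOpen_trivDomain (x₀ : X) : IsOpen (trivDomain n x₀) :=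
  (trivializationAt (EuclideanSpace ℝ (Fin n)) (TangentSpace (𝓡 n) : X → Type) x₀).open_baseSet

lemma mem_trivDomain (x₀ : X) : x₀ ∈ trivDomain n x₀ :=
  FiberBundle.mem_baseSet_trivializationAt' x₀

lemma formOfCoord_formToCoord {x₀ p : X} (hp : p ∈ trivDomain n x₀) (x : Forms n p) :
    formOfCoord x₀ p (formToCoord x₀ p x) = x := by
  have h : (((trivializationAt (EuclideanSpace ℝ (Fin n))
      (TangentSpace (𝓡 n) : X → Type) x₀).continuousLinearMapAt ℝ p).toLinearMap.dualMap ∘ₗ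
      ((trivializationAt (EuclideanSpace ℝ (Fin n))
        (TangentSpace (𝓡 n) : X → Type) x₀).symmL ℝ p).toLinearMap.dualMap) = LinearMap.id := by
    ext φ v
    exact congrArg φ (Bundle.Trivialization.symmL_continuousLinearMapAt _ hp v)
  rw [formOfCoord, formToCoord, ← AlgHom.comp_apply, ExteriorAlgebra.map_comp_map, h,
    ExteriorAlgebra.map_id, AlgHom.id_apply]

lemma formToCoord_formOfCoord {x₀ p : X} (hp : p ∈ trivDomain n x₀)
    (ξ : ExteriorAlgebra ℝ (Module.Dual ℝ (EuclideanSpace ℝ (Fin n)))) :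
    formToCoord x₀ p (formOfCoord x₀ p ξ) = ξ := by
  have h : (((trivializationAt (EuclideanSpace ℝ (Fin n))
      (TangentSpace (𝓡 n) : X → Type) x₀).symmL ℝ p).toLinearMap.dualMap ∘ₗ
      ((trivializationAt (EuclideanSpace ℝ (Fin n))
        (TangentSpace (𝓡 n) : X → Type) x₀).continuousLinearMapAt ℝ p).toLinearMap.dualMap) =
      LinearMap.id := by
    refine LinearMap.ext fun φ => LinearMap.ext fun v => ?_
    exact congrArg φ (Bundle.Trivialization.continuousLinearMapAt_symmL _ hp v)
  rw [formOfCoord, formToCoord, ← AlgHom.comp_apply, ExteriorAlgebra.map_comp_map, h,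
    ExteriorAlgebra.map_id, AlgHom.id_apply]

/-- The expression of an operator on forms in the local trivialization around `x₀`. -/
def endToCoord (x₀ p : X) : Module.End ℝ (Forms n p) →ₗ[ℝ]
    Module.End ℝ (ExteriorAlgebra ℝ (Module.Dual ℝ (EuclideanSpace ℝ (Fin n)))) :=
  LinearMap.lcomp ℝ _ (formOfCoord x₀ p).toLinearMap ∘ₗ
    LinearMap.llcomp ℝ _ _ _ (formToCoord x₀ p).toLinearMap

lemma endToCoord_apply (x₀ p : X) (A : Module.End ℝ (Forms n p))
    (ξ : ExteriorAlgebra ℝ (Module.Dual ℝ (EuclideanSpace ℝ (Fin n)))) :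
    endToCoord x₀ p A ξ = formToCoord x₀ p (A (formOfCoord x₀ p ξ)) := rfl

lemma endToCoord_mul {x₀ p : X} (hp : p ∈ trivDomain n x₀) (A B : Module.End ℝ (Forms n p)) :
    endToCoord x₀ p (A * B) = endToCoord x₀ p A * endToCoord x₀ p B :=
  LinearMap.ext fun ξ => by
    simp only [endToCoord_apply, Module.End.mul_apply, formOfCoord_formToCoord hp]

lemma endToCoord_one {x₀ p : X} (hp : p ∈ trivDomain n x₀) :
    endToCoord x₀ p (1 : Module.End ℝ (Forms n p)) = 1 :=
  LinearMap.ext fun ξ => by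
    simp only [endToCoord_apply, Module.End.one_apply, formToCoord_formOfCoord hp]

lemma endToCoord_injective {x₀ p : X} (hp : p ∈ trivDomain n x₀) :
    Function.Injective (endToCoord (n := n) x₀ p) := fun A B h => LinearMap.ext fun x => by
  have := congrArg (fun C => formOfCoord x₀ p (C (formToCoord x₀ p x))) h
  simpa only [endToCoord_apply, formOfCoord_formToCoord hp] using this

lemma smoothEndOn_iff {A : (p : X) → Module.End ℝ (Forms n p)} {U : Set X} :
    SmoothEndOn A U ↔
      ∀ x₀, SmoothVecOn n (fun p => endToCoord x₀ p (A p)) (U ∩ trivDomain n x₀) := by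
  constructor
  · intro h x₀
    exact .of_apply fun ξ l => h x₀ ξ l
  · intro h x₀ ξ l
    exact h x₀ (l ∘ₗ LinearMap.applyₗ ξ)

namespace SmoothEndOn

variable {A B : (p : X) → Module.End ℝ (Forms n p)} {U : Set X}

lemma zero : SmoothEndOn (fun p => (0 : Module.End ℝ (Forms n p))) U := fun x₀ ξ l => by
  simpa using contMDiffOn_const

lemma add (hA : SmoothEndOn A U) (hB : SmoothEndOn B U) : SmoothEndOn (fun p => A p + B p) U := by
  rw [smoothEndOn_iff] at *
  intro x₀
  simp only [map_add]
  exact (hA x₀).add (hB x₀)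

lemma smul {a : X → ℝ} (ha : ContMDiffOn (𝓡 n) 𝓘(ℝ, ℝ) ∞ a U) (hA : SmoothEndOn A U) :
    SmoothEndOn (fun p => a p • A p) U := by
  rw [smoothEndOn_iff] at *
  intro x₀
  simp only [map_smul]
  exact .smul (ha.mono Set.inter_subset_left) (hA x₀)

lemma lie (hA : SmoothEndOn A U) (hB : SmoothEndOn B U) : SmoothEndOn (fun p => ⁅A p, B p⁆) U := by
  rw [smoothEndOn_iff] at *
  intro x₀
  have h1 := (hA x₀).bilin (hB x₀) (LinearMap.mul ℝ _)
  have h2 := (hB x₀).bilin (hA x₀) (LinearMap.mul ℝ _)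
  refine (h1.add (h2.map (-LinearMap.id))).congr fun p hp => ?_
  rw [LieRing.of_associative_ring_bracket, map_sub, endToCoord_mul hp.2, endToCoord_mul hp.2,
    sub_eq_add_neg]
  rfl

end SmoothEndOn

/-! ### Smoothness of the adjoints -/

section Metric

open CliffordAlgebra

variable (g : RiemMetric n X)

/-- The coefficients of a Riemannian metric in a local trivialization are smooth. -/
lemma contMDiffOn_inner (x₀ : X) (u v : EuclideanSpace ℝ (Fin n)) :
    ContMDiffOn (𝓡 n) 𝓘(ℝ, ℝ) ∞ (fun p => g.inner p
      ((trivializationAt (EuclideanSpace ℝ (Fin n)) (TangentSpace (𝓡 n) : X → Type) x₀).symmL ℝ p u)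
      ((trivializationAt (EuclideanSpace ℝ (Fin n)) (TangentSpace (𝓡 n) : X → Type) x₀).symmL ℝ p v))
      (trivDomain n x₀) := by
  set e := trivializationAt (EuclideanSpace ℝ (Fin n)) (TangentSpace (𝓡 n) : X → Type) x₀ with he
  intro p hp
  have hp' : p ∈ e.baseSet := hp
  have hsec : ∀ w : EuclideanSpace ℝ (Fin n), ContMDiffWithinAt (𝓡 n)
      ((𝓡 n).prod 𝓘(ℝ, EuclideanSpace ℝ (Fin n))) ∞ (fun q => Bundle.TotalSpace.mk'
        (EuclideanSpace ℝ (Fin n)) (E := (TangentSpace (𝓡 n) : X → Type)) q (e.symmL ℝ q w))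
        (trivDomain n x₀) p := fun w => by
    rw [Bundle.Trivialization.contMDiffWithinAt_section (e := e) _ hp']
    refine (contMDiffWithinAt_const (c := w)).congr (fun q hq => ?_) ?_
    · have hq' : q ∈ e.baseSet := hq
      exact (congr_fun (e.coe_linearMapAt_of_mem (R := ℝ) hq') _).symm.trans
        (e.continuousLinearMapAt_symmL hq' w)
    · exact (congr_fun (e.coe_linearMapAt_of_mem (R := ℝ) hp') _).symm.trans
        (e.continuousLinearMapAt_symmL hp' w)
  have h := ContMDiffWithinAt.clm_bundle_apply₂ (F₃ := ℝ) (E₃ := Bundle.Trivial X ℝ)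
    (g.contMDiff.contMDiffAt.contMDiffWithinAt (s := trivDomain n x₀) (x := p)) (hsec u) (hsec v)
  simp only [Bundle.contMDiffWithinAt_totalSpace] at h
  exact h.2

/-- The pull-back of covectors under the local trivialization around `x₀`. -/
def covecOfCoord (x₀ p : X) : Module.Dual ℝ (EuclideanSpace ℝ (Fin n)) →ₗ[ℝ] CotSpace n p :=
  ((trivializationAt (EuclideanSpace ℝ (Fin n))
    (TangentSpace (𝓡 n) : X → Type) x₀).continuousLinearMapAt ℝ p).toLinearMap.dualMap

/-- The coefficients of the metric on covectors are smooth. The vector `w` metrically dual to a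
coordinate covector `η` solves the linear equation `g(w, ·) = η`, whose coefficients are smooth. -/
lemma contMDiffOn_cotangentForm (x₀ : X) (ξ η : Module.Dual ℝ (EuclideanSpace ℝ (Fin n))) :
    ContMDiffOn (𝓡 n) 𝓘(ℝ, ℝ) ∞
      (fun p => cotangentForm g p (covecOfCoord x₀ p ξ) (covecOfCoord x₀ p η))
      (trivDomain n x₀) := by
  let e := trivializationAt (EuclideanSpace ℝ (Fin n)) (TangentSpace (𝓡 n) : X → Type) x₀
  let sharp : (p : X) → TangentSpace (𝓡 n) p := fun p =>
    ((tangentForm g p).toDual (tangentForm_nondegenerate g p)).symm (covecOfCoord x₀ p η)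
  have hsharp : ∀ p v, tangentForm g p (sharp p) v = covecOfCoord x₀ p η v := fun p v =>
    LinearMap.BilinForm.apply_toDual_symm_apply _ _
  let T : X → EuclideanSpace ℝ (Fin n) →ₗ[ℝ] Module.Dual ℝ (EuclideanSpace ℝ (Fin n)) := fun p =>
    (tangentForm g p).compl₁₂ (e.symmL ℝ p).toLinearMap (e.symmL ℝ p).toLinearMap
  have hT : SmoothVecOn n T (trivDomain n x₀) :=
    .of_apply fun u => .of_apply fun v => .of_real (contMDiffOn_inner g x₀ u v)
  have hinj : ∀ p ∈ trivDomain n x₀, Function.Injective (T p) := fun p hp => by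
    refine (injective_iff_map_eq_zero _).2 fun u hu => ?_
    have h0 : e.symmL ℝ p u = 0 := by
      by_contra h
      exact (g.pos p _ h).ne' (congr($hu u))
    rw [← e.continuousLinearMapAt_symmL (R := ℝ) hp u, h0, map_zero]
  have hw : SmoothVecOn n (fun p => e.continuousLinearMapAt ℝ p (sharp p)) (trivDomain n x₀) := by
    refine .of_injective hT hinj ((SmoothVecOn.const η).congr fun p hp => ?_)
    refine LinearMap.ext fun v => ?_
    change tangentForm g p (e.symmL ℝ p (e.continuousLinearMapAt ℝ p (sharp p))) (e.symmL ℝ p v) = _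
    rw [e.symmL_continuousLinearMapAt hp, hsharp]
    exact congrArg η (e.continuousLinearMapAt_symmL hp v)
  refine (hw ξ).congr fun p hp => ?_
  exact LinearMap.BilinForm.apply_toDual_symm_apply (B := tangentForm g p)
    (hB := tangentForm_nondegenerate g p) (covecOfCoord x₀ p ξ) (sharp p)

lemma endToCoord_mulLeft {x₀ p : X} (hp : p ∈ trivDomain n x₀) (x : Forms n p) :
    endToCoord x₀ p (LinearMap.mulLeft ℝ x) = LinearMap.mulLeft ℝ (formToCoord x₀ p x) :=
  LinearMap.ext fun ξ => by
    simp only [endToCoord_apply, LinearMap.mulLeft_apply, map_mul, formToCoord_formOfCoord hp]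

lemma endToCoord_contractLeft {x₀ p : X} (hp : p ∈ trivDomain n x₀)
    (d : Module.Dual ℝ (CotSpace n p)) :
    endToCoord x₀ p (contractLeft d) = contractLeft (d ∘ₗ covecOfCoord x₀ p) :=
  LinearMap.ext fun ξ => by
    have := ExtMetric.map_contractLeft (covecOfCoord x₀ p) d ξ
    have h2 := congrArg (formToCoord x₀ p) this
    exact h2.symm.trans (formToCoord_formOfCoord hp _)

/-- The adjoint of the wedge product with a form with constant coefficients is smooth. It is built
from contractions with the metric duals of coordinate covectors. -/
lemma smoothVecOn_adjoint_mulLeft_formOfCoord (x₀ : X)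
    (ξ : ExteriorAlgebra ℝ (Module.Dual ℝ (EuclideanSpace ℝ (Fin n)))) :
    SmoothVecOn n (fun p => endToCoord x₀ p
      (formAdjoint g p (LinearMap.mulLeft ℝ (formOfCoord x₀ p ξ)))) (trivDomain n x₀) := by
  induction ξ using ExteriorAlgebra.induction with
  | algebraMap r =>
    refine (SmoothVecOn.const (r • 1)).congr fun p hp => ?_
    have h : LinearMap.mulLeft ℝ (formOfCoord (n := n) x₀ p (algebraMap ℝ _ r)) = r • 1 := by
      rw [AlgHom.commutes]
      exact LinearMap.ext fun x => (Algebra.smul_def r x).symm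
    have h2 : formAdjoint g p (r • 1) = r • 1 :=
      ((ExtMetric.adjointHom (cotangentForm_nondegenerate g p)).map_smul r 1).trans
        (congrArg _ (ExtMetric.adjoint_one (cotangentForm_nondegenerate g p)))
    rw [h, h2, map_smul, endToCoord_one (n := n) hp]
  | ι m =>
    have hd : SmoothVecOn n (fun p => cotangentForm g p (covecOfCoord x₀ p m) ∘ₗ
        covecOfCoord x₀ p) (trivDomain n x₀) :=
      .of_apply fun η => .of_real (contMDiffOn_cotangentForm g x₀ m η)
    refine (hd.map contractLeft).congr fun p hp => ?_
    rw [← endToCoord_contractLeft hp,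
      ← ExtMetric.adjoint_mulLeft_ι (cotangentForm_nondegenerate g p) (cotangentForm_symm g p)]
    have h : formOfCoord x₀ p (ExteriorAlgebra.ι ℝ m) = ExteriorAlgebra.ι ℝ (covecOfCoord x₀ p m) :=
      ExteriorAlgebra.map_apply_ι _ _
    rw [h]
    rfl
  | mul a b ha hb =>
    refine (hb.bilin ha (LinearMap.mul ℝ _)).congr fun p hp => ?_
    rw [map_mul, LinearMap.mulLeft_mul, LinearMap.mul_apply', ← endToCoord_mul hp]
    exact congrArg _ (ExtMetric.adjoint_mul (cotangentForm_nondegenerate g p) _ _)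
  | add a b ha hb =>
    refine (ha.add hb).congr fun p _ => ?_
    rw [map_add, ← map_add (endToCoord x₀ p)]
    exact congrArg _ ((congrArg _ (map_add (LinearMap.mul ℝ (Forms n p)) _ _)).trans
      (map_add (ExtMetric.adjointHom (cotangentForm_nondegenerate g p)) _ _))

lemma SmoothFormOn.formAdjoint_mulLeft {α : (p : X) → Forms n p} {U : Set X}
    (hα : SmoothFormOn α U) :
    SmoothEndOn (fun p => formAdjoint g p (LinearMap.mulLeft ℝ (α p))) U := by
  rw [smoothEndOn_iff]
  intro x₀
  have h : SmoothVecOn n (fun p => formToCoord x₀ p (α p)) (U ∩ trivDomain n x₀) := hα x₀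
  have hF : SmoothVecOn n (fun p => endToCoord x₀ p ∘ₗ
      ExtMetric.adjointHom (cotangentForm_nondegenerate g p) ∘ₗ LinearMap.mul ℝ (Forms n p) ∘ₗ
        (formOfCoord x₀ p).toLinearMap) (U ∩ trivDomain n x₀) :=
    .of_apply fun ξ => (smoothVecOn_adjoint_mulLeft_formOfCoord g x₀ ξ).mono Set.inter_subset_right
  refine (hF.apply h).congr fun p hp => ?_
  conv_lhs => rw [← formOfCoord_formToCoord hp.2 (α p)]
  rfl

lemma SmoothFormOn.mulLeft {α : (p : X) → Forms n p} {U : Set X}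
    (hα : SmoothFormOn α U) : SmoothEndOn (fun p => LinearMap.mulLeft ℝ (α p)) U := by
  rw [smoothEndOn_iff]
  intro x₀
  have h : SmoothVecOn n (fun p => formToCoord x₀ p (α p)) (U ∩ trivDomain n x₀) := hα x₀
  exact (h.map (LinearMap.mul ℝ _)).congr fun p hp => endToCoord_mulLeft hp.2 _

end Metric

end SmoothEnd

/-! ### Smoothness of the generators and of the trivialization -/

namespace AlmostSKahler

open LieAlgebra.Orthogonal SplitOrthogonal

variable {n : ℕ} {X : Type*} [TopologicalSpace X] [ChartedSpace (EuclideanSpace ℝ (Fin n)) X]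
  [IsManifold (𝓡 n) ∞ X] {s r c : ℕ} (S : AlmostSKahler s r c n X)

lemma smoothEndOn_L (j k : Fin (s + 1)) : SmoothEndOn (S.L j k) Set.univ :=
  (S.smooth_twoForm j k).mulLeft

lemma smoothEndOn_Λ (j k : Fin (s + 1)) : SmoothEndOn (S.Λ j k) Set.univ :=
  (S.smooth_twoForm j k).formAdjoint_mulLeft S.metric

lemma smoothEndOn_e (hs : 2 ≤ s) (i : Fin (s + 1)) : SmoothEndOn (S.e i) Set.univ := by
  rcases S.exists_formula hs i with ⟨j, k, m, -, -, h⟩ | ⟨j, k, -, h⟩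
  · rw [show S.e i = _ from funext fun p => (h p _ (S.isAdaptedCoframe_coframe p)).1]
    exact (S.smoothEndOn_L _ _).lie (S.smoothEndOn_Λ _ _)
  · rw [show S.e i = _ from funext fun p => (h p _ (S.isAdaptedCoframe_coframe p)).1]
    exact S.smoothEndOn_Λ _ _

lemma smoothEndOn_f (hs : 2 ≤ s) (i : Fin (s + 1)) : SmoothEndOn (S.f i) Set.univ := by
  rcases S.exists_formula hs i with ⟨j, k, m, -, -, h⟩ | ⟨j, k, -, h⟩
  · rw [show S.f i = _ from funext fun p => (h p _ (S.isAdaptedCoframe_coframe p)).2]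
    exact (S.smoothEndOn_L _ _).lie (S.smoothEndOn_Λ _ _)
  · rw [show S.f i = _ from funext fun p => (h p _ (S.isAdaptedCoframe_coframe p)).2]
    exact S.smoothEndOn_L _ _

/-- A family of isomorphisms with the fibres of `Lef` is a smooth trivialization as soon as it maps
generators of the Lie algebra to smooth sections. -/
lemma isSmoothTrivialization_of_generators {ι 𝔤 : Type*} [LieRing 𝔤] [LieAlgebra ℝ 𝔤]
    [FiniteDimensional ℝ 𝔤] {A : Matrix ι ι ℤ} {e f : ι → 𝔤} (h : IsSerreGenerators A e f)
    (Φ : (p : X) → 𝔤 ≃ₗ⁅ℝ⁆ S.Lef p)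
    (he : ∀ i, SmoothEndOn (fun p => (Φ p (e i) : Module.End ℝ (Forms n p))) Set.univ)
    (hf : ∀ i, SmoothEndOn (fun p => (Φ p (f i) : Module.End ℝ (Forms n p))) Set.univ) :
    S.IsSmoothTrivialization Φ := by
  have hconst : ∀ a : 𝔤, SmoothEndOn (fun p => (Φ p a : Module.End ℝ (Forms n p))) Set.univ := by
    intro a
    have ha : a ∈ LieSubalgebra.lieSpan ℝ 𝔤 (Set.range e ∪ Set.range f) := by
      rw [h.generate]; trivial
    induction ha using LieSubalgebra.lieSpan_induction with
    | mem x hx =>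
      rcases hx with ⟨i, rfl⟩ | ⟨i, rfl⟩
      exacts [he i, hf i]
    | zero =>
      simp only [map_zero, ZeroMemClass.coe_zero]
      exact .zero
    | add x y _ _ hx hy =>
      simp only [map_add, AddMemClass.coe_add]
      exact hx.add hy
    | smul t x _ hx =>
      simp only [map_smul, SetLike.val_smul]
      exact .smul contMDiffOn_const hx
    | lie x y _ _ hx hy =>
      simp only [LieEquiv.map_lie, LieSubalgebra.coe_bracket]
      exact hx.lie hy
  -- In a local trivialization `Φ` becomes a smooth family of injective linear maps.
  let T : X → X → 𝔤 →ₗ[ℝ]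
      Module.End ℝ (ExteriorAlgebra ℝ (Module.Dual ℝ (EuclideanSpace ℝ (Fin n)))) := fun x₀ p =>
    endToCoord x₀ p ∘ₗ (S.Lef p).toSubmodule.subtype ∘ₗ (Φ p).toLinearEquiv.toLinearMap
  have hT : ∀ x₀, SmoothVecOn n (T x₀) (trivDomain n x₀) := fun x₀ =>
    .of_apply fun a => (smoothEndOn_iff.1 (hconst a) x₀).mono fun p hp => ⟨trivial, hp⟩
  have hinj : ∀ x₀, ∀ p ∈ trivDomain n x₀, Function.Injective (T x₀ p) := fun x₀ p hp =>
    (endToCoord_injective hp).comp (Subtype.val_injective.comp (Φ p).injective)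
  intro U _ ξ
  rw [smoothEndOn_iff]
  constructor
  · intro hξ l p hp
    have h1 : SmoothVecOn n ξ (U ∩ trivDomain n p) :=
      .of_injective ((hT p).mono Set.inter_subset_right) (fun q hq => hinj p q hq.2) (hξ p)
    have h2 := h1 l p ⟨hp, mem_trivDomain p⟩
    exact h2.mono_of_mem_nhdsWithin (Filter.inter_mem self_mem_nhdsWithin
      (mem_nhdsWithin_of_mem_nhds ((isOpen_trivDomain p).mem_nhds (mem_trivDomain p))))
  · intro hξ x₀
    have h1 : SmoothVecOn n ξ U := hξ
    exact ((hT x₀).mono Set.inter_subset_right).apply (h1.mono Set.inter_subset_left)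

end AlmostSKahler

end

theorem mainTheorem1 (s : ℕ) (hs : 2 ≤ s) :
    ∃ E F : Fin (s + 1) → LieAlgebra.Orthogonal.so' (Fin (s + 1)) (Fin (s + 1)) ℝ,
      IsSerreGenerators (CartanMatrix.D (s + 1)) E F ∧
      ∀ (c n : ℕ) (X : Type u) [TopologicalSpace X] [ChartedSpace (EuclideanSpace ℝ (Fin n)) X]
        [IsManifold (𝓡 n) ∞ X] (S : AlmostSKahler s 2 c n X),
        (∀ p b, IsAdaptedCoframe (r := 2) (c := c) S.metric S.twoForm p b →
          ∀ i, S.e i p = raisingOp b i) ∧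
        (∀ i, SmoothEndOn (S.e i) Set.univ ∧ SmoothEndOn (S.f i) Set.univ ∧
          SmoothEndOn (fun p => ⁅S.e i p, S.f i p⁆) Set.univ) ∧
        (∀ p, ∃ (he : ∀ i, S.e i p ∈ S.Lef p) (hf : ∀ i, S.f i p ∈ S.Lef p),
          IsSerreGenerators (L := S.Lef p) (CartanMatrix.D (s + 1))
            (fun i => ⟨S.e i p, he i⟩) (fun i => ⟨S.f i p, hf i⟩)) ∧
        ∃ Φ : (p : X) → LieAlgebra.Orthogonal.so' (Fin (s + 1)) (Fin (s + 1)) ℝ ≃ₗ⁅ℝ⁆ S.Lef p,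
          S.IsSmoothTrivialization Φ ∧
          (∀ p i, (Φ p (E i) : Module.End ℝ (Forms n p)) = S.e i p ∧
            (Φ p (F i) : Module.End ℝ (Forms n p)) = S.f i p) ∧
          ∀ Ψ : (p : X) → LieAlgebra.Orthogonal.so' (Fin (s + 1)) (Fin (s + 1)) ℝ ≃ₗ⁅ℝ⁆ S.Lef p,
            (∀ p i, (Ψ p (E i) : Module.End ℝ (Forms n p)) = S.e i p ∧
              (Ψ p (F i) : Module.End ℝ (Forms n p)) = S.f i p) → Ψ = Φ := by
  have hgen := SplitOrthogonal.isSerreGenerators_so hs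
  refine ⟨SplitOrthogonal.soRaising s, SplitOrthogonal.soLowering s, hgen, ?_⟩
  intro c n X _ _ _ S
  have hE := fun (p : X) (i : Fin (s + 1)) => S.coe_lefEquiv_soRaising hs i p
  have hF := fun (p : X) (i : Fin (s + 1)) => S.coe_lefEquiv_soLowering hs i p
  refine ⟨fun p b hb i => S.e_eq_raisingOp hs hb i, fun i => ⟨S.smoothEndOn_e hs i,
    S.smoothEndOn_f hs i, (S.smoothEndOn_e hs i).lie (S.smoothEndOn_f hs i)⟩,
    fun p => ⟨fun i => S.e_mem_Lef hs i p, fun i => S.f_mem_Lef hs i p,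
      S.isSerreGenerators_Lef hs p⟩,
    S.lefEquiv hs, ?_, fun p i => ⟨hE p i, hF p i⟩, ?_⟩
  · refine S.isSmoothTrivialization_of_generators hgen _ (fun i => ?_) fun i => ?_
    · simp only [hE]
      exact S.smoothEndOn_e hs i
    · simp only [hF]
      exact S.smoothEndOn_f hs i
  · intro Ψ hΨ
    funext p
    have h : (Ψ p).toLieHom = (S.lefEquiv hs p).toLieHom :=
      hgen.hom_ext (fun i => Subtype.ext ((hΨ p i).1.trans (hE p i).symm))
        fun i => Subtype.ext ((hΨ p i).2.trans (hF p i).symm)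
    exact LieEquiv.ext fun x => LieHom.congr_fun h x
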